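/- Let $\mathbb O\simeq\mathbb R^8$ be the octonions with their standard inner product $\langle\,,\rangle$, let $L_{\mathbf x}$, $R_{\mathbf x}$ denote left and right multiplication by $\mathbf x\in\mathbb O$, and let $C$ be the conjugation $C\mathbf x=2\langle\mathbf x,\mathbf 1\rangle\mathbf 1-\mathbf x$. Realize $\mathrm{Spin}(8)$ as the group of triples $(g_1,g_2,g_3)\in \mathrm{SO}(\mathbb O)^3$ such that $g_2(\mathbf x\mathbf y)=g_1(\mathbf x)\,g_3(\mathbf y)$ for all $\mathbf x,\mathbf y\in\mathbb O$, and write an element of its Lie algebra $\mathfrak{spin}(8)$ as $a=(a_1,a_2,a_3)$. Let $\mathrm{Spin}(9,1)$ denote the connected spin group of signature $(9,1)$, that is, the double cover, inside the Clifford algebra, of the identity component of $\mathrm{SO}(9,1)$. Consider $$ \mathfrak{spin}(9,1)=\left\{\begin{pmatrix} a_1+r\,I_8 & C\,R_{\mathbf w}\\ C\,L_{\mathbf x} & a_3-r\,I_8\end{pmatrix}\ \middle|\ r\in\mathbb R,\ \mathbf w,\mathbf x\in\mathbb O,\ a\in\mathfrak{spin}(8)\right\}\subset \mathrm{End}_{\mathbb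 R}(\mathbb O^2). $$ Then: 1. $\mathfrak{spin}(9,1)$ is a Lie subalgebra of $\mathfrak{sl}(\mathbb O^2)\simeq\mathfrak{sl}(16,\mathbb R)$. 2. There is a faithful (continuous) representation $\rho:\mathrm{Spin}(9,1)\to\mathrm{GL}(\mathbb O^2)\simeq\mathrm{GL}(16,\mathbb R)$ for which the Lie algebra of the group $\rho(\mathrm{Spin}(9,1))$ is $\mathfrak{spin}(9,1)$. 3. For every such $\rho$, the action of $\mathrm{Spin}(9,1)$ on $\mathbb O^2\simeq\mathbb R^{16}$ has exactly two orbits: $\{0\}$ and the set of all nonzero vectors. -/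

import Mathlib

open scoped Quaternion

noncomputable section

/-! ### The octonions -/

/-- The octonions, by the Cayley-Dickson doubling of Hamilton's quaternions.  The `ℓ²` product
carries the standard positive definite inner product of `ℝ⁸`. -/
def Octonion : Type := WithLp 2 (ℍ[ℝ] × ℍ[ℝ])

namespace Octonion

instance : NormedAddCommGroup Octonion :=
  inferInstanceAs (NormedAddCommGroup (WithLp 2 (ℍ[ℝ] × ℍ[ℝ])))

instance : InnerProductSpace ℝ Octonion :=
  inferInstanceAs (InnerProductSpace ℝ (WithLp 2 (ℍ[ℝ] × ℍ[ℝ])))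

instance : FiniteDimensional ℝ Octonion :=
  (WithLp.linearEquiv 2 ℝ (ℍ[ℝ] × ℍ[ℝ])).symm.finiteDimensional

/-- The octonion with quaternionic components `a` and `b`. -/
def mk (a b : ℍ[ℝ]) : Octonion := WithLp.toLp 2 (a, b)

/-- The first quaternionic component. -/
def fst (x : Octonion) : ℍ[ℝ] := (WithLp.ofLp (p := 2) (V := ℍ[ℝ] × ℍ[ℝ]) x).1

/-- The second quaternionic component. -/
def snd (x : Octonion) : ℍ[ℝ] := (WithLp.ofLp (p := 2) (V := ℍ[ℝ] × ℍ[ℝ]) x).2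

theorem ext_components {x y : Octonion} (h₁ : x.fst = y.fst) (h₂ : x.snd = y.snd) : x = y :=
  congrArg (WithLp.toLp 2) (Prod.ext h₁ h₂)

instance : One Octonion := ⟨mk 1 0⟩

/-- The Cayley-Dickson product `(a, b)(c, d) = (a c - d̄ b, d a + b c̄)`. -/
instance : Mul Octonion :=
  ⟨fun x y => mk (x.fst * y.fst - star y.snd * x.snd) (y.snd * x.fst + x.snd * star y.fst)⟩

theorem fst_add (x y : Octonion) : (x + y).fst = x.fst + y.fst := rfl
theorem snd_add (x y : Octonion) : (x + y).snd = x.snd + y.snd := rfl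
theorem fst_smul (r : ℝ) (x : Octonion) : (r • x).fst = r • x.fst := rfl
theorem snd_smul (r : ℝ) (x : Octonion) : (r • x).snd = r • x.snd := rfl

theorem fst_mul (x y : Octonion) :
    (x * y).fst = x.fst * y.fst - star y.snd * x.snd := rfl

theorem snd_mul (x y : Octonion) :
    (x * y).snd = y.snd * x.fst + x.snd * star y.fst := rfl

theorem add_mul' (x y z : Octonion) : (x + y) * z = x * z + y * z := by
  apply ext_components
  · simp only [fst_mul, fst_add, snd_add]; noncomm_ring
  · simp only [snd_mul, fst_add, snd_add]; noncomm_ring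

theorem mul_add' (x y z : Octonion) : x * (y + z) = x * y + x * z := by
  apply ext_components
  · simp only [fst_mul, fst_add, snd_add, star_add]; noncomm_ring
  · simp only [snd_mul, fst_add, snd_add, star_add]; noncomm_ring

theorem smul_mul' (r : ℝ) (x y : Octonion) : (r • x) * y = r • (x * y) := by
  apply ext_components
  · simp only [fst_mul, fst_smul, snd_smul, smul_sub, smul_mul_assoc, mul_smul_comm]
  · simp only [snd_mul, fst_smul, snd_smul, smul_add, smul_mul_assoc, mul_smul_comm]

theorem mul_smul' (r : ℝ) (x y : Octonion) : x * (r • y) = r • (x * y) := by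
  apply ext_components
  · simp only [fst_mul, fst_smul, snd_smul, smul_sub, smul_mul_assoc, mul_smul_comm,
      Quaternion.star_smul]
  · simp only [snd_mul, fst_smul, snd_smul, smul_add, smul_mul_assoc, mul_smul_comm,
      Quaternion.star_smul]

/-- Left multiplication `L_x`. -/
def L (x : Octonion) : Octonion →L[ℝ] Octonion :=
  LinearMap.toContinuousLinearMap
    { toFun := fun y => x * y
      map_add' := mul_add' x
      map_smul' := fun r y => mul_smul' r x y }

/-- Right multiplication `R_x`. -/
def R (x : Octonion) : Octonion →L[ℝ] Octonion :=
  LinearMap.toContinuousLinearMap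
    { toFun := fun y => y * x
      map_add' := fun y z => add_mul' y z x
      map_smul' := fun r y => smul_mul' r y x }

/-- Conjugation `C`, given by `x ↦ 2⟨x, 1⟩ 1 - x`. -/
def C : Octonion →L[ℝ] Octonion :=
  (2 : ℝ) • (innerSL ℝ (1 : Octonion)).smulRight (1 : Octonion)
    - ContinuousLinearMap.id ℝ Octonion

end Octonion

/-! ### The Lie algebra of a group of invertible elements of a real Banach algebra -/

/-- The Lie algebra of a subgroup `G` of the group of units of `𝔸` (for instance of `GL(V)`): the
elements all of whose real multiples have their exponential in `G`. -/
def lieAlgebraOf {𝔸 : Type*} [NormedRing 𝔸] [NormedAlgebra ℝ 𝔸] (G : Subgroup 𝔸ˣ) : Set 𝔸 :=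
  {A | ∀ t : ℝ, ∃ g ∈ G, (g : 𝔸) = NormedSpace.exp (t • A)}

/-! ### `Spin(8)` by triality -/

/-- Membership in the special orthogonal group `SO(𝕆) ≃ SO(8)`. -/
def IsSpecialOrthogonal (g : Octonion →L[ℝ] Octonion) : Prop :=
  (∀ x, ‖g x‖ = ‖x‖) ∧ LinearMap.det (g : Octonion →ₗ[ℝ] Octonion) = 1

/-- The algebra in which triples `(g₁, g₂, g₃)` of endomorphisms of `𝕆` live. -/
abbrev EndTriple : Type :=
  (Octonion →L[ℝ] Octonion) × (Octonion →L[ℝ] Octonion) × (Octonion →L[ℝ] Octonion)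

/-- The triples `(g₁, g₂, g₃) ∈ SO(8)³` with `g₂ (x y) = g₁ (x) g₃ (y)` for all octonions. -/
def IsTrialityTriple (g : EndTriple) : Prop :=
  IsSpecialOrthogonal g.1 ∧ IsSpecialOrthogonal g.2.1 ∧ IsSpecialOrthogonal g.2.2 ∧
    ∀ x y : Octonion, g.2.1 (x * y) = g.1 x * g.2.2 y

theorem IsSpecialOrthogonal.one : IsSpecialOrthogonal 1 :=
  ⟨fun _ => rfl, LinearMap.det_id⟩

theorem IsSpecialOrthogonal.mul {g h : Octonion →L[ℝ] Octonion}
    (hg : IsSpecialOrthogonal g) (hh : IsSpecialOrthogonal h) : IsSpecialOrthogonal (g * h) := by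
  refine ⟨fun x => (hg.1 (h x)).trans (hh.1 x), ?_⟩
  have e : ((g * h : Octonion →L[ℝ] Octonion) : Octonion →ₗ[ℝ] Octonion)
      = (g : Octonion →ₗ[ℝ] Octonion) ∘ₗ (h : Octonion →ₗ[ℝ] Octonion) := rfl
  rw [e, LinearMap.det_comp, hg.2, hh.2, one_mul]

theorem IsSpecialOrthogonal.of_mul_eq_one {g h : Octonion →L[ℝ] Octonion}
    (hg : IsSpecialOrthogonal g) (e : g * h = 1) : IsSpecialOrthogonal h := by
  refine ⟨fun x => ?_, ?_⟩
  · rw [← hg.1 (h x)]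
    exact congrArg norm (DFunLike.congr_fun e x)
  · have e' : (g : Octonion →ₗ[ℝ] Octonion) ∘ₗ (h : Octonion →ₗ[ℝ] Octonion)
        = LinearMap.id := congrArg ContinuousLinearMap.toLinearMap e
    have d := congrArg LinearMap.det e'
    rwa [LinearMap.det_comp, hg.2, one_mul, LinearMap.det_id] at d

/-- The triality model of `Spin(8)`: the group of all triality triples. -/
def Spin8 : Subgroup EndTripleˣ where
  carrier := {g | IsTrialityTriple (g : EndTriple)}
  one_mem' := ⟨.one, .one, .one, fun _ _ => rfl⟩
  mul_mem' := fun {g h} hg hh => ⟨hg.1.mul hh.1, hg.2.1.mul hh.2.1, hg.2.2.1.mul hh.2.2.1,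
    fun x y => (congrArg (g : EndTriple).2.1 (hh.2.2.2 x y)).trans (hg.2.2.2 _ _)⟩
  inv_mem' := fun {g} hg => by
    have e : (g : EndTriple) * (g⁻¹ : EndTripleˣ) = 1 := g.mul_inv
    have e' : ((g⁻¹ : EndTripleˣ) : EndTriple) * (g : EndTriple) = 1 := g.inv_mul
    have e₁ := congrArg Prod.fst e
    have e₂ := congrArg (fun p => p.2.1) e
    have e₃ := congrArg (fun p => p.2.2) e
    have e₂' := congrArg (fun p => p.2.1) e'
    refine ⟨hg.1.of_mul_eq_one e₁, hg.2.1.of_mul_eq_one e₂, hg.2.2.1.of_mul_eq_one e₃,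
      fun x y => ?_⟩
    have h := hg.2.2.2 (((g⁻¹ : EndTripleˣ) : EndTriple).1 x)
      (((g⁻¹ : EndTripleˣ) : EndTriple).2.2 y)
    have h₁ : (g : EndTriple).1 (((g⁻¹ : EndTripleˣ) : EndTriple).1 x) = x :=
      DFunLike.congr_fun e₁ x
    have h₃ : (g : EndTriple).2.2 (((g⁻¹ : EndTripleˣ) : EndTriple).2.2 y) = y :=
      DFunLike.congr_fun e₃ y
    rw [h₁, h₃] at h
    have h₂ := DFunLike.congr_fun e₂'
      (((g⁻¹ : EndTripleˣ) : EndTriple).1 x * ((g⁻¹ : EndTripleˣ) : EndTriple).2.2 y)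
    rw [← h]
    exact h₂

/-- The Lie algebra `spin(8)`, consisting of triples `a = (a₁, a₂, a₃)`. -/
def spin8 : Set EndTriple := lieAlgebraOf Spin8

/-! ### The subspace `spin(9,1)` of `End(𝕆²)` -/

/-- The sixteen-dimensional real vector space `𝕆² ≃ ℝ¹⁶`. -/
abbrev Octonion2 : Type := Octonion × Octonion

/-- The endomorphism of `𝕆²` (columns) with the block matrix `(A B; D E)`. -/
def blockEnd (A B D E : Octonion →L[ℝ] Octonion) : Octonion2 →L[ℝ] Octonion2 :=
  ((A.comp (ContinuousLinearMap.fst ℝ Octonion Octonion)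
      + B.comp (ContinuousLinearMap.snd ℝ Octonion Octonion))).prod
    (D.comp (ContinuousLinearMap.fst ℝ Octonion Octonion)
      + E.comp (ContinuousLinearMap.snd ℝ Octonion Octonion))

/-- The displayed set of block matrices
`(a₁ + r I, C R_w; C L_x, a₃ - r I)` with `r` real, `w`, `x` octonions and `a` in `spin(8)`. -/
def spin91 : Set (Octonion2 →L[ℝ] Octonion2) :=
  {M | ∃ (r : ℝ) (w x : Octonion) (a : EndTriple), a ∈ spin8 ∧
    M = blockEnd (a.1 + r • ContinuousLinearMap.id ℝ Octonion)
      (Octonion.C.comp (Octonion.R w))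
      (Octonion.C.comp (Octonion.L x))
      (a.2.2 - r • ContinuousLinearMap.id ℝ Octonion)}

/-! ### The groups `Spin(p,q)` -/

/-- The standard quadratic form of signature `(p, q)` on `ℝ^(p+q)`. -/
def signatureForm (p q : ℕ) : QuadraticForm ℝ (Fin p ⊕ Fin q → ℝ) :=
  QuadraticMap.weightedSumSquares ℝ (Sum.elim (fun _ => (1 : ℝ)) (fun _ => (-1 : ℝ)))

/-- A real Clifford algebra carries its canonical topology as a real vector space. -/
instance {V : Type*} [AddCommGroup V] [Module ℝ V] (Q : QuadraticForm ℝ V) :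
    TopologicalSpace (CliffordAlgebra Q) :=
  moduleTopology ℝ (CliffordAlgebra Q)

/-- `Spin(p,q)`: the elements `g` of the group generated by the invertible vectors of the Clifford
algebra that are even and satisfy `g gᵗ = 1`, where `t` is the reversal (which on even elements
is `star`).  For `p = 9`, `q = 1` this is the connected double cover of the identity component
of `SO(9,1)`. -/
abbrev Spin (p q : ℕ) : Type := spinGroup (signatureForm p q)

/-- `GL(𝕆²) ≃ GL(16, ℝ)`. -/
abbrev GLOctonion2 : Type := (Octonion2 →L[ℝ] Octonion2)ˣ

/-- `ρ` is a faithful (continuous) representation of `Spin(9,1)` on `𝕆²` such that the Lie algebra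
of the group of operators `ρ(Spin(9,1))` is `spin91`. -/
structure IsFaithfulRepWithLieAlgebraSpin91 (ρ : Spin 9 1 →* GLOctonion2) : Prop where
  continuous : Continuous ρ
  faithful : Function.Injective ρ
  lieAlgebra_eq : lieAlgebraOf ρ.range = spin91

end

/-! The triple `(α, β, z)` encodes a Hermitian octonionic matrix and is realized as the symmetric
operator `X = hermOp (α, β, z)` on `𝕆²`. The form `|z|² - αβ` on these triples has signature
`(9,1)`. The key point is `spin91_eq`: the displayed block matrices are exactly the `M` for which `X
↦ M X + X Mᵀ` maps Hermitian matrices to Hermitian matrices by an operator skew for this form. For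
diagonal blocks this is infinitesimal triality; for off-diagonal blocks it is the Clifford identity
`C x (y z) + C y (x z) = 2⟨x, y⟩ z`. A stabilizer is closed under brackets, and the trace vanishes
because the components of `spin(8)` are skew and the scalars `r`, `-r` cancel.

The relation `X X̃ = |z|² - αβ`, with `X̃` the operator of `hermDual`, yields gamma matrices, hence
a representation of the Clifford algebra by `2 × 2` matrices over `End(𝕆²)`. Even elements are block
diagonal, and the upper left block is the half-spin representation. Reversal becomes a transpose, so
a spin element acts on vectors by `X ↦ g X gᵀ`. An element of the kernel commutes with all vectors,
hence is a scalar, hence is `1`.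

Differentiating `X ↦ g X gᵀ` puts the Lie algebra of the image inside the stabilizer. Conversely,
let `A` act through `D`. The isometry `exp (D/2)` is a product of reflections, so it comes from a
product `u` of unit vectors, and `u²` lies in the spin group whatever the parity and norm of `u`.
The image of `u²` inverts the action of `exp A` on Hermitian matrices, so the product of the two
fixes them all and is `±1`; both signs lie in the image.

Transitivity uses only the Lie algebra: the nilpotent off-diagonal blocks exponentiate to shears,
which change one coordinate arbitrarily while the other is nonzero. -/

noncomputable section

/-! ### Conjugation and the composition identities of the octonions -/

namespace Octonion

@[simp] theorem fst_mk (a b : ℍ[ℝ]) : (mk a b).fst = a := rfl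
@[simp] theorem snd_mk (a b : ℍ[ℝ]) : (mk a b).snd = b := rfl
@[simp] theorem fst_one : (1 : Octonion).fst = 1 := rfl
@[simp] theorem snd_one : (1 : Octonion).snd = 0 := rfl
@[simp] theorem fst_zero : (0 : Octonion).fst = 0 := rfl
@[simp] theorem snd_zero : (0 : Octonion).snd = 0 := rfl
@[simp] theorem fst_neg (x : Octonion) : (-x).fst = -x.fst := rfl
@[simp] theorem snd_neg (x : Octonion) : (-x).snd = -x.snd := rfl
@[simp] theorem fst_sub (x y : Octonion) : (x - y).fst = x.fst - y.fst := rfl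
@[simp] theorem snd_sub (x y : Octonion) : (x - y).snd = x.snd - y.snd := rfl
attribute [simp] fst_add snd_add fst_smul snd_smul fst_mul snd_mul

theorem inner_eq (x y : Octonion) :
    inner ℝ x y = inner ℝ x.fst y.fst + inner ℝ x.snd y.snd := rfl

@[simp] theorem L_apply (x y : Octonion) : L x y = x * y := rfl
@[simp] theorem R_apply (x y : Octonion) : R x y = y * x := rfl

theorem C_apply (x : Octonion) : C x = mk (star x.fst) (-x.snd) := by
  have h : C x = (2 * inner ℝ 1 x : ℝ) • (1 : Octonion) - x := by
    simp [C, smul_smul]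
  rw [h]
  apply ext_components
  · ext <;> simp [inner_eq, Quaternion.inner_def]; ring
  · ext <;> simp [inner_eq, Quaternion.inner_def]

@[simp] theorem fst_C (x : Octonion) : (C x).fst = star x.fst := by rw [C_apply]; rfl
@[simp] theorem snd_C (x : Octonion) : (C x).snd = -x.snd := by rw [C_apply]; rfl

@[simp] theorem C_C (x : Octonion) : C (C x) = x := by
  apply ext_components <;> simp

@[simp] theorem C_one : C (1 : Octonion) = 1 := by
  apply ext_components <;> simp

theorem C_mul (x y : Octonion) : C (x * y) = C y * C x := by
  apply ext_components <;> simp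

theorem inner_C_left (x y : Octonion) : inner ℝ (C x) y = inner ℝ x (C y) := by
  simp [inner_eq, Quaternion.inner_def]

theorem inner_mul_left (x y z : Octonion) : inner ℝ (x * y) z = inner ℝ y (C x * z) := by
  simp [inner_eq, Quaternion.inner_def]; ring

theorem inner_mul_right (x y z : Octonion) : inner ℝ (x * y) z = inner ℝ x (z * C y) := by
  simp [inner_eq, Quaternion.inner_def]; ring

-- This polarized form of `C x (x z) = |x|² z` is the Clifford relation behind the off-diagonal
-- blocks and the gamma matrices. It is a polynomial identity in the coordinates.
set_option maxHeartbeats 1000000 in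
theorem C_mul_mul_add (x y z : Octonion) :
    C x * (y * z) + C y * (x * z) = (2 * inner ℝ x y : ℝ) • z := by
  rw [inner_eq, Quaternion.inner_def, Quaternion.inner_def]
  apply ext_components <;> ext <;> simp <;> ring

theorem C_mul_mul_self (x z : Octonion) : C x * (x * z) = (inner ℝ x x : ℝ) • z := by
  have h := C_mul_mul_add x x z
  rw [← two_smul ℝ, mul_smul] at h
  exact smul_right_injective _ (two_ne_zero' ℝ) h

theorem mul_mul_C_self (x z : Octonion) : (z * x) * C x = (inner ℝ x x : ℝ) • z := by
  have h := congrArg C (C_mul_mul_self (C x) (C z))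
  simpa only [C_mul, C_C, map_smul, inner_C_left] using h

theorem mul_mul_C_add (x y z : Octonion) :
    (z * x) * C y + (z * y) * C x = (2 * inner ℝ x y : ℝ) • z := by
  have h := congrArg C (C_mul_mul_add (C x) (C y) (C z))
  simp only [C_mul, C_C, map_smul, inner_C_left, map_add] at h
  rwa [add_comm]

theorem mul_one' (x : Octonion) : x * 1 = x := by apply ext_components <;> simp

/-- An octonion in the (right) nucleus is real. -/
theorem eq_smul_one_of_forall_mul_assoc {c : Octonion}
    (h : ∀ x y : Octonion, (x * y) * c = x * (y * c)) : ∃ r : ℝ, c = r • (1 : Octonion) := by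
  have h1 : ∀ a b : ℍ[ℝ], c.snd * (a * b) = c.snd * b * a := fun a b => by
    simpa using congrArg snd (h (mk a 0) (mk b 0))
  obtain ⟨i, i0, i1, i2, i3⟩ : ∃ i : ℍ[ℝ], i.re = 0 ∧ i.imI = 1 ∧ i.imJ = 0 ∧ i.imK = 0 :=
    ⟨⟨0, 1, 0, 0⟩, rfl, rfl, rfl, rfl⟩
  obtain ⟨j, j0, j1, j2, j3⟩ : ∃ j : ℍ[ℝ], j.re = 0 ∧ j.imI = 0 ∧ j.imJ = 1 ∧ j.imK = 0 :=
    ⟨⟨0, 0, 1, 0⟩, rfl, rfl, rfl, rfl⟩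
  -- For `a = i`, `b = j` the identity compares `c.snd * (i j)` with `c.snd * (j i)`, its negative.
  have h3 : c.snd = 0 := by
    have e := h1 i j
    simp [Quaternion.ext_iff, i0, i1, i2, i3, j0, j1, j2, j3] at e
    ext <;> simp <;> linarith
  -- The doubling unit `mk 0 1` makes `c.fst` commute with all quaternions; testing on `i` and `j`
  -- makes it real.
  have h2 : ∀ b : ℍ[ℝ], star b * star c.fst = star c.fst * star b := fun b => by
    simpa [h3] using congrArg snd (h (mk 0 1) (mk b 0))
  refine ⟨c.fst.re, ext_components ?_ (by simp [h3])⟩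
  have e1 := h2 i
  have e2 := h2 j
  simp [Quaternion.ext_iff, i0, i1, i2, i3, j0, j1, j2, j3] at e1 e2
  ext <;> simp <;> linarith

end Octonion

/-! ### Exponentials of endomorphisms -/

section Exp

variable {F : Type*} [NormedAddCommGroup F] [NormedSpace ℝ F] [CompleteSpace F]

theorem hasDerivAt_exp_smul_apply (a : F →L[ℝ] F) (x : F) (t : ℝ) :
    HasDerivAt (fun s : ℝ => NormedSpace.exp (s • a) x) (a (NormedSpace.exp (t • a) x)) t := by
  have h := (hasDerivAt_exp_smul_const' (𝕂 := ℝ) a t).clm_apply (hasDerivAt_const t x)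
  simpa using h

omit [CompleteSpace F] in
theorem exp_zero_smul_apply (a : F →L[ℝ] F) (x : F) : NormedSpace.exp ((0 : ℝ) • a) x = x := by
  simp [NormedSpace.exp_zero]

theorem exp_smul_mul_exp_neg_smul {𝔸 : Type*} [NormedRing 𝔸] [NormedAlgebra ℝ 𝔸]
    [CompleteSpace 𝔸] (a : 𝔸) (t : ℝ) :
    NormedSpace.exp (t • a) * NormedSpace.exp (-t • a) = 1 := by
  have : NormedAlgebra ℚ 𝔸 := NormedAlgebra.restrictScalars ℚ ℝ 𝔸
  rw [← NormedSpace.exp_add_of_commute, ← add_smul, add_neg_cancel, zero_smul,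
    NormedSpace.exp_zero]
  exact ((Commute.refl a).smul_left _).smul_right _

/-- Uniqueness for a linear differential equation: `exp (-s a) (f s)` has zero derivative.
Identities between exponentials are obtained below by exhibiting two solutions of one equation. -/
theorem eq_exp_smul_apply_of_hasDerivAt {a : F →L[ℝ] F} {f : ℝ → F}
    (h : ∀ s, HasDerivAt f (a (f s)) s) (t : ℝ) : f t = NormedSpace.exp (t • a) (f 0) := by
  have hd : ∀ s : ℝ, HasDerivAt (fun s : ℝ => NormedSpace.exp (-s • a) (f s)) 0 s := fun s => by
    have h1 : HasDerivAt (fun s : ℝ => NormedSpace.exp (-s • a))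
        (-(NormedSpace.exp (-s • a) * a)) s := by
      have h2 := (hasDerivAt_exp_smul_const (𝕂 := ℝ) a (-s)).scomp s (hasDerivAt_neg s)
      rwa [neg_one_smul] at h2
    simpa using h1.clm_apply (h s)
  have hc := is_const_of_deriv_eq_zero (fun s => (hd s).differentiableAt)
    (fun s => (hd s).deriv) t 0
  simp only [neg_zero, exp_zero_smul_apply] at hc
  rw [← hc]
  exact (DFunLike.congr_fun (exp_smul_mul_exp_neg_smul a t) (f t)).symm

theorem exp_eq_sq {𝔸 : Type*} [NormedRing 𝔸] [NormedAlgebra ℝ 𝔸]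
    [CompleteSpace 𝔸] (a : 𝔸) :
    NormedSpace.exp a = NormedSpace.exp ((2⁻¹ : ℝ) • a) * NormedSpace.exp ((2⁻¹ : ℝ) • a) := by
  have : NormedAlgebra ℚ 𝔸 := NormedAlgebra.restrictScalars ℚ ℝ 𝔸
  rw [← NormedSpace.exp_add_of_commute (Commute.refl _), ← add_smul]
  norm_num

theorem exists_unit_eq_exp {𝔸 : Type*} [NormedRing 𝔸] [NormedAlgebra ℝ 𝔸]
    [CompleteSpace 𝔸] (a : 𝔸) : ∃ u : 𝔸ˣ, (u : 𝔸) = NormedSpace.exp a := by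
  have h1 := exp_smul_mul_exp_neg_smul a 1
  have h2 := exp_smul_mul_exp_neg_smul a (-1)
  rw [neg_neg] at h2
  rw [one_smul] at h1 h2
  exact ⟨⟨_, _, h1, h2⟩, rfl⟩

end Exp

namespace Octonion

instance : CompleteSpace Octonion := FiniteDimensional.complete ℝ Octonion

/-- Octonion multiplication as a continuous bilinear map. -/
def mulL : Octonion →L[ℝ] Octonion →L[ℝ] Octonion :=
  LinearMap.toContinuousLinearMap
    { toFun := L
      map_add' := fun x y => ContinuousLinearMap.ext fun z => add_mul' x y z
      map_smul' := fun r x => ContinuousLinearMap.ext fun z => smul_mul' r x z }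

@[simp] theorem mulL_apply (x y : Octonion) : mulL x y = x * y := rfl

end Octonion

open Octonion

/-! ### The infinitesimal description of `spin(8)` -/

/-- Skew-symmetric endomorphisms of `𝕆`. -/
def IsSkew (a : Octonion →L[ℝ] Octonion) : Prop :=
  ∀ x y, inner ℝ (a x) y = - inner ℝ x (a y)

theorem isSkew_of_norm_exp {a : Octonion →L[ℝ] Octonion}
    (h : ∀ (t : ℝ) x, ‖NormedSpace.exp (t • a) x‖ = ‖x‖) : IsSkew a := by
  intro x y
  have hin : ∀ t : ℝ, inner ℝ (NormedSpace.exp (t • a) x) (NormedSpace.exp (t • a) y)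
      = inner ℝ x y := fun t => by
    rw [real_inner_eq_norm_add_mul_self_sub_norm_mul_self_sub_norm_mul_self_div_two, ← map_add,
      h, h, h, ← real_inner_eq_norm_add_mul_self_sub_norm_mul_self_sub_norm_mul_self_div_two]
  have hd := (hasDerivAt_exp_smul_apply a x 0).inner ℝ (hasDerivAt_exp_smul_apply a y 0)
  simp only [hin, exp_zero_smul_apply] at hd
  have := hd.unique (hasDerivAt_const (0 : ℝ) (inner ℝ x y))
  linarith

theorem IsSkew.inner_self_eq_zero {a : Octonion →L[ℝ] Octonion} (h : IsSkew a) (x : Octonion) :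
    inner ℝ x (a x) = (0 : ℝ) := by
  have := h x x
  rw [real_inner_comm] at this
  linarith

theorem IsSkew.norm_exp_smul {a : Octonion →L[ℝ] Octonion} (h : IsSkew a) (t : ℝ)
    (x : Octonion) : ‖NormedSpace.exp (t • a) x‖ = ‖x‖ := by
  have hd : ∀ s : ℝ, HasDerivAt (fun s : ℝ => inner ℝ (NormedSpace.exp (s • a) x)
      (NormedSpace.exp (s • a) x)) (0 : ℝ) s := fun s => by
    have hd := (hasDerivAt_exp_smul_apply a x s).inner ℝ (hasDerivAt_exp_smul_apply a x s)
    rwa [h, h.inner_self_eq_zero, neg_zero, add_zero] at hd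
  have hc := is_const_of_deriv_eq_zero (fun s => (hd s).differentiableAt)
    (fun s => (hd s).deriv) t 0
  simp only [exp_zero_smul_apply, real_inner_self_eq_norm_sq] at hc
  exact (sq_eq_sq₀ (norm_nonneg _) (norm_nonneg _)).1 hc

theorem det_mul_self_eq_one {g : Octonion →L[ℝ] Octonion} (h : ∀ x, ‖g x‖ = ‖x‖) :
    LinearMap.det (g : Octonion →ₗ[ℝ] Octonion) * LinearMap.det (g : Octonion →ₗ[ℝ] Octonion)
      = 1 := by
  let f : Octonion →ₗᵢ[ℝ] Octonion := ⟨g, h⟩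
  have hn : |LinearMap.det (g : Octonion →ₗ[ℝ] Octonion)| = 1 :=
    (LinearMap.normDet_eq_abs_det _).symm.trans f.normDet_eq_one
  rw [← sq, ← sq_abs, hn, one_pow]

/-- The exponential is the square of the isometry `exp (t a / 2)`, whose determinant is `±1`; this
avoids a connectedness argument. -/
theorem IsSkew.isSpecialOrthogonal_exp {a : Octonion →L[ℝ] Octonion} (h : IsSkew a) (t : ℝ) :
    IsSpecialOrthogonal (NormedSpace.exp (t • a)) := by
  refine ⟨h.norm_exp_smul t, ?_⟩
  rw [exp_eq_sq, smul_smul]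
  exact (LinearMap.det_comp _ _).trans (det_mul_self_eq_one (h.norm_exp_smul _))

/-- Differentiation at `0` gives the linearized conditions. Conversely, the derivation rule makes
the two sides of the triality identity solve the same linear equation. -/
theorem mem_spin8_iff {a : EndTriple} :
    a ∈ spin8 ↔ IsSkew a.1 ∧ IsSkew a.2.1 ∧ IsSkew a.2.2 ∧
      ∀ x y : Octonion, a.2.1 (x * y) = a.1 x * y + x * a.2.2 y := by
  have : NormedAlgebra ℚ (Octonion →L[ℝ] Octonion) := NormedAlgebra.restrictScalars ℚ ℝ _
  have e1 : ∀ t : ℝ, (NormedSpace.exp (t • a)).1 = NormedSpace.exp (t • a.1) :=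
    fun t => Prod.fst_exp _
  have e2 : ∀ t : ℝ, (NormedSpace.exp (t • a)).2.1 = NormedSpace.exp (t • a.2.1) :=
    fun t => (congrArg Prod.fst (Prod.snd_exp _)).trans (Prod.fst_exp _)
  have e3 : ∀ t : ℝ, (NormedSpace.exp (t • a)).2.2 = NormedSpace.exp (t • a.2.2) :=
    fun t => (congrArg Prod.snd (Prod.snd_exp _)).trans (Prod.snd_exp _)
  constructor
  · intro ha
    have ht : ∀ t : ℝ, IsTrialityTriple (NormedSpace.exp (t • a)) := fun t => by
      obtain ⟨g, hg, e⟩ := ha t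
      rw [← e]; exact hg
    refine ⟨isSkew_of_norm_exp fun t => by rw [← e1]; exact (ht t).1.1,
      isSkew_of_norm_exp fun t => by rw [← e2]; exact (ht t).2.1.1,
      isSkew_of_norm_exp fun t => by rw [← e3]; exact (ht t).2.2.1.1, fun x y => ?_⟩
    have h : ∀ t : ℝ, NormedSpace.exp (t • a.2.1) (x * y)
        = mulL (NormedSpace.exp (t • a.1) x) (NormedSpace.exp (t • a.2.2) y) := fun t => by
      rw [← e1, ← e2, ← e3]; exact (ht t).2.2.2 x y
    have hd := mulL.hasDerivAt_of_bilinear (fun _ => hasDerivAt_exp_smul_apply a.1 x 0)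
      (fun _ => hasDerivAt_exp_smul_apply a.2.2 y 0)
    simp only [← h, exp_zero_smul_apply] at hd
    have hu := (hasDerivAt_exp_smul_apply a.2.1 (x * y) 0).unique hd
    rw [exp_zero_smul_apply] at hu
    rw [hu, add_comm]; rfl
  · rintro ⟨h1, h2, h3, h⟩ t
    obtain ⟨u, hu⟩ := exists_unit_eq_exp (t • a)
    refine ⟨u, ?_, hu⟩
    change IsTrialityTriple _
    rw [hu]
    refine ⟨e1 t ▸ h1.isSpecialOrthogonal_exp t, e2 t ▸ h2.isSpecialOrthogonal_exp t,
      e3 t ▸ h3.isSpecialOrthogonal_exp t, fun x y => ?_⟩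
    rw [e1, e2, e3]
    let F : ℝ → Octonion := fun s => mulL (NormedSpace.exp (s • a.1) x)
      (NormedSpace.exp (s • a.2.2) y)
    have hF : ∀ s, HasDerivAt F (a.2.1 (F s)) s := fun s => by
      have hd := mulL.hasDerivAt_of_bilinear (fun _ => hasDerivAt_exp_smul_apply a.1 x s)
        (fun _ => hasDerivAt_exp_smul_apply a.2.2 y s)
      convert hd using 1
      simp only [F, mulL_apply, h]
      rw [add_comm]
    have := eq_exp_smul_apply_of_hasDerivAt hF t
    simpa [F] using this.symm

/-! ### Adjoints of the conjugated multiplications -/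

namespace Octonion

theorem adjoint_C_comp_R (z : Octonion) :
    ContinuousLinearMap.adjoint (C.comp (R z)) = C.comp (L z) := by
  refine ((ContinuousLinearMap.eq_adjoint_iff _ _).2 fun x y => ?_).symm
  change inner ℝ (C (z * x)) y = inner ℝ x (C (y * z))
  rw [inner_C_left, inner_mul_left, C_mul]

theorem adjoint_C_comp_L (z : Octonion) :
    ContinuousLinearMap.adjoint (C.comp (L z)) = C.comp (R z) := by
  rw [← adjoint_C_comp_R, ContinuousLinearMap.adjoint_adjoint]

@[simp] theorem mul_zero' (x : Octonion) : x * 0 = 0 := (L x).map_zero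
@[simp] theorem zero_mul' (x : Octonion) : 0 * x = 0 := (R x).map_zero

end Octonion

/-- Endomorphisms of `𝕆²`. -/
abbrev End2 : Type := Octonion2 →L[ℝ] Octonion2

/-! ### Block matrices and transposition -/

@[simp] theorem blockEnd_apply (A B D E : Octonion →L[ℝ] Octonion) (v : Octonion2) :
    blockEnd A B D E v = (A v.1 + B v.2, D v.1 + E v.2) := rfl

theorem blockEnd_injective {A B D E A' B' D' E' : Octonion →L[ℝ] Octonion}
    (h : blockEnd A B D E = blockEnd A' B' D' E') : A = A' ∧ B = B' ∧ D = D' ∧ E = E' := by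
  have h1 := fun x => DFunLike.congr_fun h (x, 0)
  have h2 := fun x => DFunLike.congr_fun h (0, x)
  simp only [blockEnd_apply, map_zero, add_zero, zero_add, Prod.mk.injEq] at h1 h2
  exact ⟨ContinuousLinearMap.ext fun x => (h1 x).1, ContinuousLinearMap.ext fun x => (h2 x).1,
    ContinuousLinearMap.ext fun x => (h1 x).2, ContinuousLinearMap.ext fun x => (h2 x).2⟩

theorem exists_eq_blockEnd (M : End2) : ∃ A B D E, M = blockEnd A B D E := by
  refine ⟨(ContinuousLinearMap.fst ℝ _ _).comp (M.comp (ContinuousLinearMap.inl ℝ _ _)),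
    (ContinuousLinearMap.fst ℝ _ _).comp (M.comp (ContinuousLinearMap.inr ℝ _ _)),
    (ContinuousLinearMap.snd ℝ _ _).comp (M.comp (ContinuousLinearMap.inl ℝ _ _)),
    (ContinuousLinearMap.snd ℝ _ _).comp (M.comp (ContinuousLinearMap.inr ℝ _ _)), ?_⟩
  refine ContinuousLinearMap.ext fun v => ?_
  have h : v = (v.1, 0) + (0, v.2) := by simp
  conv_lhs => rw [h, map_add]
  rfl

theorem blockEnd_mul (A B D E A' B' D' E' : Octonion →L[ℝ] Octonion) :
    blockEnd A B D E * blockEnd A' B' D' E' =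
      blockEnd (A * A' + B * D') (A * B' + B * E') (D * A' + E * D') (D * B' + E * E') := by
  refine ContinuousLinearMap.ext fun v => ?_
  apply Prod.ext
  · change A (A' v.1 + B' v.2) + B (D' v.1 + E' v.2) =
      (A (A' v.1) + B (D' v.1)) + (A (B' v.2) + B (E' v.2))
    rw [map_add, map_add]; abel
  · change D (A' v.1 + B' v.2) + E (D' v.1 + E' v.2) =
      (D (A' v.1) + E (D' v.1)) + (D (B' v.2) + E (E' v.2))
    rw [map_add, map_add]; abel

theorem blockEnd_add (A B D E A' B' D' E' : Octonion →L[ℝ] Octonion) :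
    blockEnd A B D E + blockEnd A' B' D' E' =
      blockEnd (A + A') (B + B') (D + D') (E + E') := by
  refine ContinuousLinearMap.ext fun v => ?_
  simp only [add_apply, blockEnd_apply, Prod.mk_add_mk]
  congr 1 <;> abel

theorem blockEnd_smul (r : ℝ) (A B D E : Octonion →L[ℝ] Octonion) :
    r • blockEnd A B D E = blockEnd (r • A) (r • B) (r • D) (r • E) := by
  refine ContinuousLinearMap.ext fun v => ?_
  simp only [smul_apply, blockEnd_apply, Prod.smul_mk, smul_add]

theorem blockEnd_one : blockEnd 1 0 0 1 = 1 := by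
  refine ContinuousLinearMap.ext fun v => ?_
  simp

/-- The transpose of an endomorphism of `𝕆²`. -/
def transposeEnd : End2 →ₗ[ℝ] End2 where
  toFun M := blockEnd
    (ContinuousLinearMap.adjoint
      ((ContinuousLinearMap.fst ℝ _ _).comp (M.comp (ContinuousLinearMap.inl ℝ _ _))))
    (ContinuousLinearMap.adjoint
      ((ContinuousLinearMap.snd ℝ _ _).comp (M.comp (ContinuousLinearMap.inl ℝ _ _))))
    (ContinuousLinearMap.adjoint
      ((ContinuousLinearMap.fst ℝ _ _).comp (M.comp (ContinuousLinearMap.inr ℝ _ _))))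
    (ContinuousLinearMap.adjoint
      ((ContinuousLinearMap.snd ℝ _ _).comp (M.comp (ContinuousLinearMap.inr ℝ _ _))))
  map_add' M N := by
    simp only [ContinuousLinearMap.add_comp, ContinuousLinearMap.comp_add, map_add, blockEnd_add]
  map_smul' r M := by
    simp only [ContinuousLinearMap.smul_comp, ContinuousLinearMap.comp_smul,
      LinearIsometryEquiv.map_smulₛₗ, blockEnd_smul, RingHom.id_apply, conj_trivial]

/-- The product `𝕆 × 𝕆` carries the sup norm rather than an inner product, so the transpose is
assembled from adjoints of blocks. -/
theorem transposeEnd_blockEnd (A B D E : Octonion →L[ℝ] Octonion) :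
    transposeEnd (blockEnd A B D E) =
      blockEnd (ContinuousLinearMap.adjoint A) (ContinuousLinearMap.adjoint D)
        (ContinuousLinearMap.adjoint B) (ContinuousLinearMap.adjoint E) := by
  change blockEnd _ _ _ _ = _
  congr 2 <;> ext x <;> simp

theorem transposeEnd_mul (M N : End2) :
    transposeEnd (M * N) = transposeEnd N * transposeEnd M := by
  obtain ⟨A, B, D, E, rfl⟩ := exists_eq_blockEnd M
  obtain ⟨A', B', D', E', rfl⟩ := exists_eq_blockEnd N
  simp only [transposeEnd_blockEnd, blockEnd_mul, map_add, ← ContinuousLinearMap.star_eq_adjoint,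
    star_mul]

theorem transposeEnd_one : transposeEnd 1 = 1 := by
  rw [← blockEnd_one, transposeEnd_blockEnd]
  simp only [← ContinuousLinearMap.star_eq_adjoint, star_one, star_zero]

/-! ### Hermitian octonionic `2 × 2` matrices as vectors of signature `(9,1)` -/

/-- The coordinates `(α, β, z)` of a Hermitian octonionic `2 × 2` matrix. -/
abbrev Herm2 : Type := ℝ × ℝ × Octonion

/-- The polar form of the quadratic form `|z|² - αβ` on Hermitian octonionic matrices. -/
def hermPolar (v w : Herm2) : ℝ := 2 * inner ℝ v.2.2 w.2.2 - v.1 * w.2.1 - v.2.1 * w.1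

/-- The symmetric operator on `𝕆²` defined by a Hermitian octonionic matrix. -/
def hermOp : Herm2 →ₗ[ℝ] End2 where
  toFun w := blockEnd (w.1 • 1) (C.comp (R w.2.2)) (C.comp (L w.2.2)) (w.2.1 • 1)
  map_add' v w := by
    rw [blockEnd_add]
    congr 1
    · exact add_smul _ _ _
    · ext x : 1
      simp [mul_add']
    · ext x : 1
      simp [add_mul']
    · exact add_smul _ _ _
  map_smul' r w := by
    rw [RingHom.id_apply, blockEnd_smul]
    congr 1
    · exact mul_smul _ _ _
    · ext x : 1
      simp [mul_smul']
    · ext x : 1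
      simp [smul_mul']
    · exact mul_smul _ _ _

theorem hermOp_apply (w : Herm2) :
    hermOp w = blockEnd (w.1 • 1) (C.comp (R w.2.2)) (C.comp (L w.2.2)) (w.2.1 • 1) := rfl

/-- Reading off the coordinates of a Hermitian matrix from its operator. -/
def hermCoord : End2 →ₗ[ℝ] Herm2 where
  toFun M := (inner ℝ 1 (M (1, 0)).1, inner ℝ 1 (M (0, 1)).2, C (M (1, 0)).2)
  map_add' M N := by simp [inner_add_right]
  map_smul' r M := by simp [inner_smul_right]

theorem inner_one_one : inner ℝ (1 : Octonion) (1 : Octonion) = (1 : ℝ) := by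
  rw [inner_eq, Quaternion.inner_def]
  simp

theorem hermCoord_hermOp (w : Herm2) : hermCoord (hermOp w) = w := by
  obtain ⟨α, β, z⟩ := w
  have h : ∀ r : ℝ, inner ℝ (1 : Octonion) (r • (1 : Octonion)) = r := fun r => by
    rw [inner_smul_right, inner_one_one, mul_one]
  simp [hermCoord, hermOp_apply, mul_one', h]

theorem hermOp_injective : Function.Injective hermOp :=
  Function.LeftInverse.injective hermCoord_hermOp

theorem transposeEnd_hermOp (w : Herm2) : transposeEnd (hermOp w) = hermOp w := by
  rw [hermOp_apply, transposeEnd_blockEnd, adjoint_C_comp_R, adjoint_C_comp_L]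
  simp [← ContinuousLinearMap.star_eq_adjoint]

/-! ### The Lie algebra stabilizing the Hermitian matrices -/

/-- `M` acts on Hermitian matrices, infinitesimally, through `D`. -/
structure ActsThrough (M : End2) (D : Herm2 →L[ℝ] Herm2) : Prop where
  skew : ∀ v w, hermPolar (D v) w + hermPolar v (D w) = 0
  action : ∀ w, M * hermOp w + hermOp w * transposeEnd M = hermOp (D w)

theorem hermPolar_comm (v w : Herm2) : hermPolar v w = hermPolar w v := by
  simp only [hermPolar, real_inner_comm]; ring

theorem hermPolar_add_left (u v w : Herm2) :
    hermPolar (u + v) w = hermPolar u w + hermPolar v w := by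
  simp only [hermPolar, Prod.fst_add, Prod.snd_add, inner_add_left]; ring

theorem hermPolar_smul_left (r : ℝ) (v w : Herm2) :
    hermPolar (r • v) w = r * hermPolar v w := by
  simp only [hermPolar, Prod.smul_fst, Prod.smul_snd, inner_smul_left, smul_eq_mul, conj_trivial]
  ring

theorem hermPolar_add_right (u v w : Herm2) :
    hermPolar w (u + v) = hermPolar w u + hermPolar w v := by
  simp only [hermPolar_comm w, hermPolar_add_left]

theorem hermPolar_smul_right (r : ℝ) (v w : Herm2) :
    hermPolar w (r • v) = r * hermPolar w v := by
  simp only [hermPolar_comm w, hermPolar_smul_left]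

theorem hermPolar_sub_left (u v w : Herm2) :
    hermPolar (u - v) w = hermPolar u w - hermPolar v w := by
  rw [sub_eq_add_neg, ← neg_one_smul ℝ v, hermPolar_add_left, hermPolar_smul_left]; ring

theorem hermPolar_sub_right (u v w : Herm2) :
    hermPolar w (u - v) = hermPolar w u - hermPolar w v := by
  simp only [hermPolar_comm w, hermPolar_sub_left]

theorem ActsThrough.zero : ActsThrough 0 0 :=
  ⟨fun v w => by simp [hermPolar], fun w => by simp⟩

theorem ActsThrough.add {M N : End2} {D E : Herm2 →L[ℝ] Herm2} (hM : ActsThrough M D)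
    (hN : ActsThrough N E) : ActsThrough (M + N) (D + E) := by
  refine ⟨fun v w => ?_, fun w => ?_⟩
  · rw [add_apply, add_apply, hermPolar_add_left,
      hermPolar_add_right]
    linear_combination hM.skew v w + hN.skew v w
  · rw [add_apply, map_add, map_add, ← hM.action, ← hN.action]
    noncomm_ring

theorem ActsThrough.smul (r : ℝ) {M : End2} {D : Herm2 →L[ℝ] Herm2} (hM : ActsThrough M D) :
    ActsThrough (r • M) (r • D) := by
  refine ⟨fun v w => ?_, fun w => ?_⟩
  · rw [smul_apply, smul_apply, hermPolar_smul_left,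
      hermPolar_smul_right]
    linear_combination r * hM.skew v w
  · rw [smul_apply, map_smul, map_smul, ← hM.action, smul_mul_assoc,
      mul_smul_comm, smul_add]

theorem ActsThrough.sub {M N : End2} {D E : Herm2 →L[ℝ] Herm2} (hM : ActsThrough M D)
    (hN : ActsThrough N E) : ActsThrough (M - N) (D - E) := by
  have h := hM.add (hN.smul (-1))
  have e1 : M + (-1 : ℝ) • N = M - N := by module
  have e2 : D + (-1 : ℝ) • E = D - E := by module
  rwa [e1, e2] at h

/-- Since transposition reverses products, `M ↦ (X ↦ M X + X Mᵀ)` respects commutators. This is the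
whole proof of closure under brackets; no block product has to be computed. -/
theorem ActsThrough.bracket {M N : End2} {D E : Herm2 →L[ℝ] Herm2} (hM : ActsThrough M D)
    (hN : ActsThrough N E) : ActsThrough (M * N - N * M) (D.comp E - E.comp D) := by
  refine ⟨fun v w => ?_, fun w => ?_⟩
  · simp only [sub_apply, ContinuousLinearMap.comp_apply, hermPolar_sub_left,
      hermPolar_sub_right]
    linear_combination hM.skew (E v) w - hN.skew (D v) w - hN.skew v (D w) + hM.skew v (E w)
  · simp only [sub_apply, ContinuousLinearMap.comp_apply, map_sub,
      ← hM.action (E w), ← hN.action (D w), ← hM.action w, ← hN.action w, transposeEnd_mul]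
    simp only [sub_mul, mul_sub, add_mul, mul_add, mul_assoc]
    abel

/-- The Lie algebra of endomorphisms of `𝕆²` that preserve, infinitesimally, the Hermitian matrices
and their quadratic form. -/
def hermStabilizer : Submodule ℝ End2 where
  carrier := {M | ∃ D, ActsThrough M D}
  zero_mem' := ⟨0, .zero⟩
  add_mem' := fun ⟨_, h⟩ ⟨_, h'⟩ => ⟨_, h.add h'⟩
  smul_mem' := fun r _ ⟨_, h⟩ => ⟨_, h.smul r⟩

theorem IsSkew.adjoint_eq {a : Octonion →L[ℝ] Octonion} (h : IsSkew a) :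
    ContinuousLinearMap.adjoint a = -a := by
  refine ((ContinuousLinearMap.eq_adjoint_iff _ _).2 fun x y => ?_).symm
  rw [neg_apply, inner_neg_left, h, neg_neg]

theorem isSkew_of_adjoint_eq {a : Octonion →L[ℝ] Octonion}
    (h : ContinuousLinearMap.adjoint a = -a) : IsSkew a := by
  intro x y
  rw [← ContinuousLinearMap.adjoint_inner_right, h, neg_apply, inner_neg_right]

/-- Triality permutes the components of a triple, up to conjugation. -/
theorem triality_rotate {a₁ a₂ a₃ : Octonion →L[ℝ] Octonion} (h₁ : IsSkew a₁) (h₂ : IsSkew a₂)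
    (h : ∀ x y, a₂ (x * y) = a₁ x * y + x * a₃ y) (y z : Octonion) :
    C (a₁ (C (y * z))) = a₃ y * z + y * C (a₂ (C z)) := by
  refine ext_inner_right ℝ fun u => ?_
  -- After pairing with `u`, multiplications move across the inner product at the cost of a
  -- conjugation, and the claim becomes the given identity at `(C u, y)` paired with `C z`.
  have e := h (C u) y
  have e1 : inner ℝ (C (a₁ (C (y * z)))) u = - inner ℝ (C z) (a₁ (C u) * y) := by
    rw [inner_C_left, h₁, C_mul, inner_mul_right, C_C]
  have e2 : inner ℝ (a₃ y * z) u = inner ℝ (C z) (C u * a₃ y) := by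
    rw [← C_C (a₃ y * z), inner_C_left, C_mul, inner_mul_right, C_C]
  have e3 : inner ℝ (y * C (a₂ (C z))) u = inner ℝ (a₂ (C z)) (C u * y) := by
    rw [← C_C (y * _), inner_C_left, C_mul, inner_mul_right, C_C, C_C]
  rw [inner_add_left, e1, e2, e3, h₂, e, inner_add_right]
  ring

/-- The inverse rotation, with `τ` in the role of `C a₂ C`; it recovers the middle component of a
triple from the action on Hermitian matrices. -/
theorem triality_rotate_symm {a₁ τ a₃ : Octonion →L[ℝ] Octonion} (h₁ : IsSkew a₁)
    (hτ : IsSkew τ) (h : ∀ y z, C (a₁ (C (y * z))) = a₃ y * z + y * τ z) (x y : Octonion) :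
    C (τ (C (x * y))) = a₁ x * y + x * a₃ y := by
  refine ext_inner_right ℝ fun u => ?_
  have e := h y (C u)
  have e1 : inner ℝ (C (τ (C (x * y)))) u = - inner ℝ (C x) (y * τ (C u)) := by
    rw [inner_C_left, hτ, C_mul, inner_mul_left, C_C]
  have e2 : inner ℝ (C x) (C (a₁ (C (y * C u)))) = - inner ℝ (a₁ x * y) u := by
    rw [inner_C_left, C_C, C_mul, C_C, inner_mul_right, h₁, neg_neg]
  have e3 : inner ℝ (x * a₃ y) u = inner ℝ (C x) (a₃ y * C u) := by
    rw [inner_mul_right, inner_C_left, C_mul, C_C]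
  rw [e, inner_add_right] at e2
  rw [inner_add_left, e1, e3]
  linarith

/-! ### Generators of the stabilizer -/

theorem C_R_mul_C_L_add (w z : Octonion) :
    C.comp (R w) * C.comp (L z) + C.comp (R z) * C.comp (L w) = (2 * inner ℝ w z : ℝ) • 1 := by
  ext x : 1
  change C (C (z * x) * w) + C (C (w * x) * z) = (2 * inner ℝ w z : ℝ) • x
  simp only [C_mul, C_C, C_mul_mul_add]

theorem C_L_mul_C_R_add (w z : Octonion) :
    C.comp (L w) * C.comp (R z) + C.comp (L z) * C.comp (R w) = (2 * inner ℝ w z : ℝ) • 1 := by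
  ext x : 1
  change C (w * C (x * z)) + C (z * C (x * w)) = (2 * inner ℝ w z : ℝ) • x
  simp only [C_mul, C_C, mul_mul_C_add, real_inner_comm]

theorem actsThrough_scaling (r : ℝ) :
    ∃ D, ActsThrough (blockEnd (r • 1) 0 0 (-(r • 1))) D := by
  refine ⟨LinearMap.toContinuousLinearMap
    { toFun := fun w => (2 * r * w.1, -(2 * r * w.2.1), 0)
      map_add' := fun v w => by ext <;> simp <;> ring
      map_smul' := fun s v => by ext <;> simp <;> ring }, fun v w => ?_, fun w => ?_⟩
  · simp [hermPolar]; ring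
  · simp only [hermOp_apply, transposeEnd_blockEnd, blockEnd_mul, blockEnd_add,
      ← ContinuousLinearMap.star_eq_adjoint]
    congr 1 <;> ext x : 1 <;> simp [smul_smul] <;> module

/-- The Clifford relation `C_R_mul_C_L_add` turns the upper left entry of `M X + X Mᵀ` into the
scalar `2⟨u, z⟩`. -/
theorem actsThrough_upper (u : Octonion) :
    ∃ D, ActsThrough (blockEnd 0 (C.comp (R u)) 0 0) D := by
  refine ⟨LinearMap.toContinuousLinearMap
    { toFun := fun w => (2 * inner ℝ u w.2.2, 0, w.2.1 • u)
      map_add' := fun v w => by simp [inner_add_right, mul_add, add_smul]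
      map_smul' := fun s v => by simp [inner_smul_right, mul_smul]; ring }, fun v w => ?_,
      fun w => ?_⟩
  · simp [hermPolar, inner_smul_left, inner_smul_right, real_inner_comm]; ring
  · simp only [hermOp_apply, transposeEnd_blockEnd, blockEnd_mul, blockEnd_add,
      adjoint_C_comp_R, map_zero, zero_mul, mul_zero, zero_add, add_zero, C_R_mul_C_L_add]
    congr 1 <;> ext x : 1 <;> simp [mul_smul', smul_mul']

theorem actsThrough_lower (u : Octonion) :
    ∃ D, ActsThrough (blockEnd 0 0 (C.comp (L u)) 0) D := by
  refine ⟨LinearMap.toContinuousLinearMap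
    { toFun := fun w => (0, 2 * inner ℝ u w.2.2, w.1 • u)
      map_add' := fun v w => by simp [inner_add_right, mul_add, add_smul]
      map_smul' := fun s v => by simp [inner_smul_right, mul_smul]; ring }, fun v w => ?_,
      fun w => ?_⟩
  · simp [hermPolar, inner_smul_left, inner_smul_right, real_inner_comm]; ring
  · simp only [hermOp_apply, transposeEnd_blockEnd, blockEnd_mul, blockEnd_add,
      adjoint_C_comp_L, map_zero, zero_mul, mul_zero, zero_add, add_zero, C_L_mul_C_R_add]
    congr 1 <;> ext x : 1 <;> simp [mul_smul', smul_mul']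

/-- By rotated triality, `a₁ (C R_z) - (C R_z) a₃` is again of the form `C R_{z'}`, with `z' = C (a₂
(C z))`. The diagonal coordinates are killed because `a₁` and `a₃` are skew. -/
theorem actsThrough_spin8 {a : EndTriple} (ha : a ∈ spin8) :
    ∃ D, ActsThrough (blockEnd a.1 0 0 a.2.2) D := by
  obtain ⟨h1, h2, h3, h⟩ := mem_spin8_iff.1 ha
  refine ⟨(0 : Herm2 →L[ℝ] ℝ).prod ((0 : Herm2 →L[ℝ] ℝ).prod ((C.comp (a.2.1.comp C)).comp
    ((ContinuousLinearMap.snd ℝ ℝ Octonion).comp (ContinuousLinearMap.snd ℝ ℝ _)))),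
    fun v w => ?_, fun w => ?_⟩
  · simp [hermPolar, inner_C_left]
    rw [h2, inner_C_left]
    ring
  · have e : ∀ z, a.1 * C.comp (R z) - C.comp (R z) * a.2.2 = C.comp (R (C (a.2.1 (C z)))) :=
      fun z => by
        ext y : 1
        change a.1 (C (y * z)) - C (a.2.2 y * z) = C (y * C (a.2.1 (C z)))
        have := congrArg C (triality_rotate h1 h2 h y z)
        rw [C_C, map_add] at this
        rw [this]; abel
    have e' := congrArg ContinuousLinearMap.adjoint (e w.2.2)
    simp only [map_sub, ← ContinuousLinearMap.star_eq_adjoint, star_mul] at e'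
    simp only [ContinuousLinearMap.star_eq_adjoint, h1.adjoint_eq, h3.adjoint_eq,
      adjoint_C_comp_R] at e'
    simp only [hermOp_apply, transposeEnd_blockEnd, blockEnd_mul, blockEnd_add,
      h1.adjoint_eq, h3.adjoint_eq, map_zero, zero_mul, mul_zero, zero_add, add_zero]
    congr 1
    · simp
    · simpa [sub_eq_add_neg] using e w.2.2
    · simp at e' ⊢
      rw [← e']; abel
    · simp

theorem exists_mem_spin8_of_actsThrough {a₁ a₃ : Octonion →L[ℝ] Octonion} (s1 : IsSkew a₁)
    (s3 : IsSkew a₃) {D : Herm2 →L[ℝ] Herm2} (hD : ActsThrough (blockEnd a₁ 0 0 a₃) D) :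
    ∃ a₂, ((a₁, a₂, a₃) : EndTriple) ∈ spin8 := by
  obtain ⟨τ, hτ⟩ : ∃ τ : Octonion →L[ℝ] Octonion, ∀ z, τ z = (D (0, 0, z)).2.2 :=
    ⟨((ContinuousLinearMap.snd ℝ ℝ Octonion).comp
      (ContinuousLinearMap.snd ℝ ℝ (ℝ × Octonion))).comp
        (D.comp ((ContinuousLinearMap.inr ℝ ℝ (ℝ × Octonion)).comp
          (ContinuousLinearMap.inr ℝ ℝ Octonion))), fun _ => rfl⟩
  have sτ : IsSkew τ := by
    intro y z
    have := hD.skew (0, 0, y) (0, 0, z)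
    simp only [hermPolar, mul_zero, zero_mul, sub_zero, ← hτ] at this
    linarith
  have tri : ∀ y z, C (a₁ (C (y * z))) = a₃ y * z + y * τ z := fun y z => by
    have k := hD.action (0, 0, z)
    simp only [hermOp_apply, transposeEnd_blockEnd, blockEnd_mul, blockEnd_add,
      s1.adjoint_eq, s3.adjoint_eq, map_zero, zero_mul, mul_zero, zero_add, add_zero] at k
    have k' : a₁ (C (y * z)) + C (-a₃ y * z) = C (y * τ z) := by
      rw [hτ]
      exact DFunLike.congr_fun (blockEnd_injective k).2.1 y
    replace k' := congrArg C k'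
    rw [map_add, C_C, C_C, ← neg_one_smul ℝ (a₃ y), smul_mul', neg_one_smul] at k'
    rw [← k']; abel
  refine ⟨C.comp (τ.comp C), mem_spin8_iff.2 ⟨s1, fun y z => ?_, s3,
    triality_rotate_symm s1 sτ tri⟩⟩
  change inner ℝ (C (τ (C y))) z = - inner ℝ y (C (τ (C z)))
  rw [inner_C_left, sτ, inner_C_left]

/-- `spin91` is the Lie algebra stabilizing the Hermitian matrices and their quadratic form. -/
theorem spin91_eq : spin91 = (hermStabilizer : Set End2) := by
  ext M
  constructor
  · rintro ⟨r, w, x, a, ha, rfl⟩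
    have e : blockEnd (a.1 + r • ContinuousLinearMap.id ℝ Octonion) (C.comp (R w))
        (C.comp (L x)) (a.2.2 - r • ContinuousLinearMap.id ℝ Octonion)
        = blockEnd (r • 1) 0 0 (-(r • 1)) + blockEnd 0 (C.comp (R w)) 0 0
          + blockEnd 0 0 (C.comp (L x)) 0 + blockEnd a.1 0 0 a.2.2 := by
      simp only [blockEnd_add, add_zero, zero_add]
      congr 1
      · exact add_comm _ _
      · exact (neg_add_eq_sub _ _).symm
    rw [e]
    exact add_mem (add_mem (add_mem (actsThrough_scaling r) (actsThrough_upper w))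
      (actsThrough_lower x)) (actsThrough_spin8 ha)
  · rintro ⟨D, hD⟩
    obtain ⟨a, b, c, d, rfl⟩ := exists_eq_blockEnd M
    -- The two diagonal idempotents reveal the off-diagonal blocks of `M` and the symmetric parts of
    -- its diagonal blocks, which are scalar. Skewness of `D` on this pair makes the two scalars
    -- opposite.
    have k1 := hD.action (1, 0, 0)
    have k2 := hD.action (0, 1, 0)
    have k3 := hD.skew (1, 0, 0) (0, 1, 0)
    have hR : C.comp (R 0) = 0 := by ext x : 1; simp
    have hL : C.comp (L 0) = 0 := by ext x : 1; simp
    simp only [hermOp_apply, transposeEnd_blockEnd, blockEnd_mul, blockEnd_add, hR, hL, one_smul,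
      zero_smul, mul_zero, zero_mul, mul_one, one_mul, add_zero, zero_add] at k1 k2
    obtain ⟨k11, -, k13, -⟩ := blockEnd_injective k1
    obtain ⟨-, k22, -, k24⟩ := blockEnd_injective k2
    simp only [hermPolar, inner_zero_left, inner_zero_right, mul_zero, mul_one, zero_mul,
      sub_zero, one_mul, zero_sub] at k3
    set r : ℝ := (D (1, 0, 0)).1 / 2 with hr
    set x := (D (1, 0, 0)).2.2
    set w := (D (0, 1, 0)).2.2
    obtain ⟨D1, h1⟩ := actsThrough_scaling r
    obtain ⟨D2, h2⟩ := actsThrough_upper w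
    obtain ⟨D3, h3⟩ := actsThrough_lower x
    -- Removing the scaling and the two off-diagonal generators leaves a block diagonal element with
    -- skew blocks, where triality applies.
    have hN := hD.sub ((h1.add h2).add h3)
    have hD' : ActsThrough (blockEnd (a - r • 1) 0 0 (d + r • 1)) (D - (D1 + D2 + D3)) := by
      convert hN using 1
      rw [eq_sub_iff_add_eq]
      simp only [blockEnd_add, k22, k13]
      congr 1 <;> abel
    have s1 : IsSkew (a - r • 1) := by
      apply isSkew_of_adjoint_eq
      have e : ContinuousLinearMap.adjoint a = (2 * r) • 1 - a := by
        rw [eq_sub_iff_add_eq', k11, hr]; congr 1; ring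
      rw [map_sub, e]
      simp only [← ContinuousLinearMap.star_eq_adjoint, star_smul, star_one, star_trivial]
      module
    have s3 : IsSkew (d + r • 1) := by
      apply isSkew_of_adjoint_eq
      have e : ContinuousLinearMap.adjoint d = (-2 * r) • 1 - d := by
        rw [eq_sub_iff_add_eq', k24, hr]; congr 1; linarith
      rw [map_add, e]
      simp only [← ContinuousLinearMap.star_eq_adjoint, star_smul, star_one, star_trivial]
      module
    obtain ⟨a₂, h₂⟩ := exists_mem_spin8_of_actsThrough s1 s3 hD'
    refine ⟨r, w, x, (a - r • 1, a₂, d + r • 1), h₂, ?_⟩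
    rw [k22, k13]
    congr 1
    · exact (sub_add_cancel _ _).symm
    · exact (add_sub_cancel_right _ _).symm

/-! ### Trace -/

theorem IsSkew.trace_eq_zero {a : Octonion →L[ℝ] Octonion} (h : IsSkew a) :
    LinearMap.trace ℝ Octonion (a : Octonion →ₗ[ℝ] Octonion) = 0 := by
  rw [LinearMap.trace_eq_sum_inner _ (stdOrthonormalBasis ℝ Octonion)]
  exact Finset.sum_eq_zero fun i _ => h.inner_self_eq_zero _

theorem trace_blockEnd (A B D E : Octonion →L[ℝ] Octonion) :
    LinearMap.trace ℝ Octonion2 (blockEnd A B D E : Octonion2 →ₗ[ℝ] Octonion2)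
      = LinearMap.trace ℝ Octonion (A : Octonion →ₗ[ℝ] Octonion)
        + LinearMap.trace ℝ Octonion (E : Octonion →ₗ[ℝ] Octonion) := by
  have e : (blockEnd A B D E : Octonion2 →ₗ[ℝ] Octonion2)
      = LinearMap.prodMap (A : Octonion →ₗ[ℝ] Octonion) (E : Octonion →ₗ[ℝ] Octonion)
        + LinearMap.inl ℝ _ _ ∘ₗ ((B : Octonion →ₗ[ℝ] Octonion) ∘ₗ LinearMap.snd ℝ _ _)
        + LinearMap.inr ℝ _ _ ∘ₗ ((D : Octonion →ₗ[ℝ] Octonion) ∘ₗ LinearMap.fst ℝ _ _) := by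
    refine LinearMap.ext fun v => ?_
    simp [add_comm]
  rw [e, map_add, map_add, LinearMap.trace_prodMap',
    ← LinearMap.trace_comp_comm' (LinearMap.inl ℝ Octonion Octonion),
    ← LinearMap.trace_comp_comm' (LinearMap.inr ℝ Octonion Octonion), LinearMap.comp_assoc,
    LinearMap.comp_assoc, LinearMap.snd_comp_inl, LinearMap.fst_comp_inr]
  simp

theorem trace_eq_zero_of_mem_spin91 {M : End2} (h : M ∈ spin91) :
    LinearMap.trace ℝ Octonion2 (M : Octonion2 →ₗ[ℝ] Octonion2) = 0 := by
  obtain ⟨r, w, x, a, ha, rfl⟩ := h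
  obtain ⟨h1, -, h3, -⟩ := mem_spin8_iff.1 ha
  have e1 := h1.trace_eq_zero
  have e3 := h3.trace_eq_zero
  rw [trace_blockEnd, ContinuousLinearMap.toLinearMap_add, ContinuousLinearMap.toLinearMap_sub,
    map_add, map_sub, e1, e3]
  ring

/-! ### Elements of a Clifford algebra commuting with all vectors -/

namespace ExteriorAlgebra

variable {V : Type*} [AddCommGroup V] [Module ℝ V] {κ : Type*} [Fintype κ]

/-- The number operator of the exterior algebra. -/
def numberOp (b : Module.Basis κ ℝ V) : ExteriorAlgebra ℝ V →ₗ[ℝ] ExteriorAlgebra ℝ V :=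
  ∑ i, LinearMap.mulLeft ℝ (ι ℝ (b i)) ∘ₗ CliffordAlgebra.contractLeft (b.coord i)

theorem numberOp_apply (b : Module.Basis κ ℝ V) (x : ExteriorAlgebra ℝ V) :
    numberOp b x = ∑ i, ι ℝ (b i) * CliffordAlgebra.contractLeft (b.coord i) x := by
  simp [numberOp]

/-- Contraction is an antiderivation and vectors anticommute, so the two signs cancel; the extra
term sums to `v` by the basis expansion. -/
theorem numberOp_ι_mul (b : Module.Basis κ ℝ V) (v : V) (x : ExteriorAlgebra ℝ V) :
    numberOp b (ι ℝ v * x) = ι ℝ v * x + ι ℝ v * numberOp b x := by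
  have h : ∀ i, ι ℝ (b i) * CliffordAlgebra.contractLeft (b.coord i) (ι ℝ v * x)
      = ι ℝ (b.coord i v • b i) * x
        + ι ℝ v * (ι ℝ (b i) * CliffordAlgebra.contractLeft (b.coord i) x) := fun i => by
    have e : CliffordAlgebra.contractLeft (b.coord i) (ι ℝ v * x) = b.coord i v • x
        - ι ℝ v * CliffordAlgebra.contractLeft (b.coord i) x :=
      CliffordAlgebra.contractLeft_ι_mul _ _ _
    have s : ι ℝ (b i) * ι ℝ v = - (ι ℝ v * ι ℝ (b i)) :=
      eq_neg_of_add_eq_zero_left (ι_add_mul_swap _ _)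
    rw [e, mul_sub, ← mul_assoc, s, neg_mul, sub_neg_eq_add, mul_assoc, map_smul, mul_smul_comm,
      smul_mul_assoc]
  rw [numberOp_apply, numberOp_apply, Finset.mul_sum, Finset.sum_congr rfl fun i _ => h i,
    Finset.sum_add_distrib, ← Finset.sum_mul, ← map_sum]
  simp only [Module.Basis.coord_apply, b.sum_repr]

theorem numberOp_of_mem (b : Module.Basis κ ℝ V) {k : ℕ} {x : ExteriorAlgebra ℝ V}
    (hx : x ∈ ⋀[ℝ]^k V) : numberOp b x = (k : ℝ) • x := by
  induction k generalizing x with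
  | zero =>
    obtain ⟨r, rfl⟩ := Submodule.mem_one.1
      ((pow_zero (LinearMap.range (ι ℝ (M := V)))).le hx)
    simp only [numberOp_apply, Nat.cast_zero, zero_smul]
    exact Finset.sum_eq_zero fun i _ =>
      (congrArg _ (CliffordAlgebra.contractLeft_algebraMap _ _ _)).trans (mul_zero _)
  | succ k ih =>
    replace hx : x ∈ LinearMap.range (ι ℝ (M := V)) * LinearMap.range (ι ℝ (M := V)) ^ k :=
      (pow_succ' (LinearMap.range (ι ℝ (M := V))) k).le hx
    induction hx using Submodule.mul_induction_on' with
    | mem_mul_mem m hm n hn =>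
      obtain ⟨v, rfl⟩ := hm
      rw [numberOp_ι_mul, ih hn, mul_smul_comm]
      push_cast
      module
    | add x _ y _ hx hy => rw [map_add, hx, hy, smul_add]

theorem proj_numberOp (b : Module.Basis κ ℝ V) (k : ℕ) (x : ExteriorAlgebra ℝ V) :
    GradedAlgebra.proj (fun i : ℕ => ⋀[ℝ]^i V) k (numberOp b x)
      = (k : ℝ) • GradedAlgebra.proj (fun i : ℕ => ⋀[ℝ]^i V) k x := by
  induction x using DirectSum.Decomposition.inductionOn (fun i : ℕ => ⋀[ℝ]^i V) with
  | zero => simp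
  | @homogeneous i m =>
    rw [numberOp_of_mem b m.2, map_smul]
    by_cases h : i = k
    · subst h; rfl
    · have e : GradedAlgebra.proj (fun i : ℕ => ⋀[ℝ]^i V) k (m : ExteriorAlgebra ℝ V) = 0 :=
        DirectSum.decompose_of_mem_ne (fun i : ℕ => ⋀[ℝ]^i V) m.2 h
      rw [e, smul_zero, smul_zero]
  | add x y hx hy => rw [map_add, map_add, map_add, hx, hy, smul_add]

open scoped Classical in
theorem mem_range_algebraMap_of_contractLeft_eq_zero (b : Module.Basis κ ℝ V)
    {x : ExteriorAlgebra ℝ V}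
    (h : ∀ d : Module.Dual ℝ V, CliffordAlgebra.contractLeft d x = 0) :
    ∃ r : ℝ, x = algebraMap ℝ _ r := by
  -- The number operator multiplies degree `k` by `k`, so its kernel is the degree zero part, the
  -- scalars.
  have h0 : numberOp b x = 0 := by
    rw [numberOp_apply]
    exact Finset.sum_eq_zero fun i _ => by rw [h, mul_zero]
  have hk : ∀ k : ℕ, k ≠ 0 → GradedAlgebra.proj (fun i : ℕ => ⋀[ℝ]^i V) k x = 0 := fun k hk => by
    have := proj_numberOp b k x
    rw [h0, map_zero] at this
    exact (smul_eq_zero.1 this.symm).resolve_left (Nat.cast_ne_zero.2 hk)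
  have hx : x = GradedAlgebra.proj (fun i : ℕ => ⋀[ℝ]^i V) 0 x := by
    conv_lhs => rw [← DirectSum.sum_support_decompose (fun i : ℕ => ⋀[ℝ]^i V) x]
    refine Finset.sum_eq_single 0 (fun k _ h => hk k h) fun hn => ?_
    rw [DFinsupp.notMem_support_iff] at hn
    rw [hn]; rfl
  have hm : x ∈ ⋀[ℝ]^0 V := by
    rw [hx]; exact SetLike.coe_mem _
  obtain ⟨r, hr⟩ := Submodule.mem_one.1
    ((pow_zero (LinearMap.range (ι ℝ (M := V)))).le hm)
  exact ⟨r, hr.symm⟩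

end ExteriorAlgebra

/-! ### Twisted commutators, reflections and products of unit vectors -/

namespace CliffordAlgebra

variable {V : Type*} [AddCommGroup V] [Module ℝ V] {Q : QuadraticForm ℝ V}

/-- Both sides kill scalars and obey the same antiderivation rule, with value `polar Q v w` on a
vector `w`. On even elements the left side is an ordinary commutator. -/
theorem ι_mul_sub_involute_mul_ι (v : V) (x : CliffordAlgebra Q) :
    ι Q v * x - involute x * ι Q v = contractLeft (QuadraticMap.polarBilin Q v) x := by
  induction x using CliffordAlgebra.left_induction with
  | algebraMap r =>
    rw [contractLeft_algebraMap, AlgHom.commutes, Algebra.commutes, sub_self]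
  | add x y hx hy => rw [map_add, map_add, ← hx, ← hy]; noncomm_ring
  | ι_mul x w hx =>
    have e : ι Q v * ι Q w = algebraMap ℝ _ (QuadraticMap.polar Q v w) - ι Q w * ι Q v :=
      eq_sub_of_add_eq (ι_mul_ι_add_swap v w)
    rw [contractLeft_ι_mul, ← hx, map_mul, involute_ι, ← mul_assoc, e, sub_mul, mul_sub,
      QuadraticMap.polarBilin_apply_apply, Algebra.smul_def]
    noncomm_ring

/-- An even element that commutes with all vectors is a scalar if the form is nondegenerate. -/
theorem exists_eq_algebraMap_of_commute {κ : Type*} [Fintype κ] (b : Module.Basis κ ℝ V)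
    (hQ : Function.Surjective (QuadraticMap.polarBilin Q)) {x : CliffordAlgebra Q}
    (hx : involute x = x) (h : ∀ v, ι Q v * x = x * ι Q v) : ∃ r : ℝ, x = algebraMap ℝ _ r := by
  have hc : ∀ d, contractLeft d x = 0 := fun d => by
    obtain ⟨v, rfl⟩ := hQ d
    rw [← ι_mul_sub_involute_mul_ι, hx, h, sub_self]
  -- The linear isomorphism with the exterior algebra commutes with contractions and fixes scalars.
  obtain ⟨r, hr⟩ := ExteriorAlgebra.mem_range_algebraMap_of_contractLeft_eq_zero b
    (x := equivExterior Q x) fun d => by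
      have := changeForm_contractLeft changeForm.associated_neg_proof d x
      rw [hc, map_zero] at this
      exact this.symm
  refine ⟨r, (equivExterior Q).injective ?_⟩
  rw [hr]
  exact (changeForm_algebraMap changeForm.associated_neg_proof r).symm

/-! ### Isometries as products of reflections -/

/-- The reflection in a vector. -/
def reflect (Q : QuadraticForm ℝ V) (v : V) : V →ₗ[ℝ] V :=
  LinearMap.id - ((Q v)⁻¹ • QuadraticMap.polarBilin Q v).smulRight v

theorem reflect_apply (v w : V) :
    reflect Q v w = w - ((Q v)⁻¹ * QuadraticMap.polar Q v w) • v := by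
  simp [reflect]

theorem reflect_apply_of_polar_eq_zero {v w : V} (h : QuadraticMap.polar Q v w = 0) :
    reflect Q v w = w := by
  rw [reflect_apply, h, mul_zero, zero_smul, sub_zero]

theorem map_reflect {v : V} (hv : Q v ≠ 0) (w : V) : Q (reflect Q v w) = Q w := by
  rw [reflect_apply, sub_eq_add_neg, ← neg_smul, QuadraticMap.map_add Q, QuadraticMap.map_smul,
    QuadraticMap.polar_smul_right, QuadraticMap.polar_comm Q w v]
  simp only [smul_eq_mul]
  field_simp
  ring

theorem ι_mul_ι_eq_neg_reflect {v : V} (hv : Q v ≠ 0) (w : V) :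
    ι Q v * ι Q w = -(ι Q (reflect Q v w) * ι Q v) := by
  have e : ι Q v * ι Q w = algebraMap ℝ _ (QuadraticMap.polar Q v w) - ι Q w * ι Q v :=
    eq_sub_of_add_eq (ι_mul_ι_add_swap v w)
  have c : (Q v)⁻¹ * QuadraticMap.polar Q v w * Q v = QuadraticMap.polar Q v w := by
    field_simp
  rw [e, reflect_apply, map_sub, map_smul, sub_mul, smul_mul_assoc, ι_sq_scalar, neg_sub,
    Algebra.smul_def, ← map_mul (algebraMap ℝ (CliffordAlgebra Q)), c]

/-- The product of the vectors of a list. -/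
abbrev vectorProd (Q : QuadraticForm ℝ V) (l : List V) : CliffordAlgebra Q := (l.map (ι Q)).prod

/-- Vectors of square `±1`. -/
def IsUnitVector (Q : QuadraticForm ℝ V) (v : V) : Prop := Q v = 1 ∨ Q v = -1

theorem exists_isUnitVector_smul {v : V} (hv : Q v ≠ 0) :
    ∃ c : ℝ, IsUnitVector Q (c • v) := by
  have h : 0 < |Q v| := abs_pos.2 hv
  refine ⟨(√|Q v|)⁻¹, ?_⟩
  have e : Q ((√|Q v|)⁻¹ • v) = |Q v|⁻¹ * Q v := by
    rw [QuadraticMap.map_smul, smul_eq_mul, ← mul_inv, Real.mul_self_sqrt h.le]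
  rw [IsUnitVector, e]
  rcases abs_choice (Q v) with h' | h' <;> rw [h']
  · exact Or.inl (inv_mul_cancel₀ hv)
  · right; field_simp

/-- `u` is a product of unit vectors that transforms `S` into `T`, up to sign. -/
def Intertwines (Q : QuadraticForm ℝ V) (l : List V) (S T : V →ₗ[ℝ] V) : Prop :=
  (∀ v ∈ l, IsUnitVector Q v) ∧ ∀ w, vectorProd Q l * ι Q (S w)
    = (-1 : ℝ) ^ l.length • (ι Q (T w) * vectorProd Q l)

/-- A normalized multiple of `v` is prepended; moving it past a vector reflects that vector and
contributes one sign. -/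
theorem Intertwines.reflect {l : List V} {S T : V →ₗ[ℝ] V} (h : Intertwines Q l S T) {v : V}
    (hv : Q v ≠ 0) : ∃ l', Intertwines Q l' S (reflect Q v ∘ₗ T) := by
  obtain ⟨c, hc⟩ := exists_isUnitVector_smul hv
  refine ⟨c • v :: l, fun w hw => ?_, fun w => ?_⟩
  · rcases List.mem_cons.1 hw with rfl | hw
    · exact hc
    · exact h.1 w hw
  · rw [vectorProd, List.map_cons, List.prod_cons, mul_assoc, h.2, mul_smul_comm, ← mul_assoc,
      map_smul, smul_mul_assoc, ι_mul_ι_eq_neg_reflect hv, List.length_cons, pow_succ,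
      LinearMap.comp_apply]
    simp only [smul_mul_assoc, mul_smul_comm, neg_mul, smul_neg, mul_neg, mul_one, neg_smul,
      mul_assoc]

/-- The Cartan–Dieudonné argument for an orthogonal family of anisotropic vectors, one member at a
time. The reflecting vectors are orthogonal to the members already fixed, so these stay fixed. -/
theorem exists_intertwines_fixing {κ : Type*} [DecidableEq κ] {e : κ → V}
    (he : ∀ i, Q (e i) ≠ 0) (ho : ∀ i j, i ≠ j → QuadraticMap.polar Q (e i) (e j) = 0)
    {S : V →ₗ[ℝ] V} (hS : ∀ w, Q (S w) = Q w) (s : Finset κ) :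
    ∃ l T, Intertwines Q l S T ∧ (∀ w, Q (T w) = Q w) ∧ ∀ i ∈ s, T (e i) = e i := by
  induction s using Finset.induction_on with
  | empty => exact ⟨[], S, ⟨by simp, fun w => by simp [vectorProd]⟩, hS, by simp⟩
  | insert j s hj ih =>
    obtain ⟨l, T, hl, hT, hs⟩ := ih
    have hp : ∀ v w, QuadraticMap.polar Q (T v) (T w) = QuadraticMap.polar Q v w := fun v w => by
      simp only [QuadraticMap.polar, ← map_add, hT]
    have h0 : ∀ i ∈ s, QuadraticMap.polar Q (T (e j)) (e i) = 0 := fun i hi => by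
      have hij : j ≠ i := fun h => hj (h ▸ hi)
      conv_lhs => rw [← hs i hi]
      rw [hp, ho j i hij]
    have h0' : ∀ i ∈ s, QuadraticMap.polar Q (e j) (e i) = 0 := fun i hi =>
      ho j i fun h => hj (h ▸ hi)
    have hself : ∀ v, QuadraticMap.polar Q v v = 2 * Q v := fun v => by
      rw [QuadraticMap.polar_self, two_smul, two_mul]
    set p := QuadraticMap.polar Q (T (e j)) (e j) with hpdef
    have hp' : QuadraticMap.polar Q (e j) (T (e j)) = p := QuadraticMap.polar_comm _ _ _
    have hminus : Q (T (e j) - e j) = 2 * Q (e j) - p := by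
      rw [sub_eq_add_neg, QuadraticMap.map_add Q, QuadraticMap.map_neg, hT,
        QuadraticMap.polar_neg_right, hpdef]
      ring
    by_cases hv : Q (T (e j) - e j) = 0
    · have hplus : Q (T (e j) + e j) = 2 * Q (e j) + p := by
        rw [QuadraticMap.map_add Q, hT, hpdef]; ring
      -- The values of `Q` at `T (e j) ± e j` add up to `4 Q (e j) ≠ 0`. If the difference is
      -- isotropic, reflecting in the sum sends `T (e j)` to `-e j`, and reflecting in `e j`
      -- corrects the sign.
      have hv' : Q (T (e j) + e j) ≠ 0 := by
        intro h
        apply he j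
        linarith
      obtain ⟨l', hl'⟩ := hl.reflect hv'
      obtain ⟨l'', hl''⟩ := hl'.reflect (he j)
      refine ⟨l'', _, hl'', fun w => ?_, fun i hi => ?_⟩
      · rw [LinearMap.comp_apply, LinearMap.comp_apply, map_reflect (he j), map_reflect hv', hT]
      · rw [LinearMap.comp_apply, LinearMap.comp_apply]
        rcases Finset.mem_insert.1 hi with rfl | hi
        · have e1 : CliffordAlgebra.reflect Q (T (e i) + e i) (T (e i)) = -e i := by
            rw [reflect_apply, QuadraticMap.polar_add_left, hself, hT, hp', ← hplus,
              inv_mul_cancel₀ hv', one_smul]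
            abel
          have e2 : (Q (e i))⁻¹ * (2 * Q (e i)) = 2 := by have := he i; field_simp
          rw [e1, map_neg, reflect_apply, hself, e2]
          module
        · rw [hs i hi, reflect_apply_of_polar_eq_zero (v := T (e j) + e j),
            reflect_apply_of_polar_eq_zero (h0' i hi)]
          rw [QuadraticMap.polar_add_left, h0 i hi, h0' i hi, add_zero]
    · obtain ⟨l', hl'⟩ := hl.reflect hv
      refine ⟨l', _, hl', fun w => ?_, fun i hi => ?_⟩
      · rw [LinearMap.comp_apply, map_reflect hv, hT]
      · rw [LinearMap.comp_apply]
        rcases Finset.mem_insert.1 hi with rfl | hi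
        · rw [reflect_apply, QuadraticMap.polar_sub_left, hself, hT, hp', ← hminus,
            inv_mul_cancel₀ hv, one_smul]
          abel
        · rw [hs i hi, reflect_apply_of_polar_eq_zero]
          rw [QuadraticMap.polar_sub_left, h0 i hi, h0' i hi, sub_zero]

theorem exists_intertwines_id {κ : Type*} [Fintype κ] {e : κ → V}
    (hspan : Submodule.span ℝ (Set.range e) = ⊤)
    (he : ∀ i, Q (e i) ≠ 0) (ho : ∀ i j, i ≠ j → QuadraticMap.polar Q (e i) (e j) = 0)
    {S : V →ₗ[ℝ] V} (hS : ∀ w, Q (S w) = Q w) :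
    ∃ l, Intertwines Q l S LinearMap.id := by
  classical
  obtain ⟨l, T, hl, -, hT⟩ := exists_intertwines_fixing he ho hS Finset.univ
  have : T = LinearMap.id := LinearMap.ext_on_range hspan fun i => hT i (Finset.mem_univ i)
  exact ⟨l, this ▸ hl⟩

theorem vectorProd_mem_lipschitzGroup {l : List V} (h : ∀ v ∈ l, IsUnitVector Q v) :
    vectorProd Q l ∈ (lipschitzGroup Q).toSubmonoid.map (Units.coeHom <| CliffordAlgebra Q) := by
  refine Submonoid.list_prod_mem _ fun x hx => ?_
  obtain ⟨v, hv, rfl⟩ := List.mem_map.1 hx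
  have hu : IsUnit (ι Q v) := by
    apply isUnit_ι_of_isUnit
    rcases h v hv with h | h <;> rw [h] <;> simp
  obtain ⟨u, hu⟩ := hu
  exact ⟨u, Subgroup.subset_closure ⟨v, hu.symm⟩, hu⟩

theorem star_vectorProd_mul {l : List V} (h : ∀ v ∈ l, IsUnitVector Q v) :
    ∃ c : ℝ, c * c = 1 ∧ star (vectorProd Q l) * vectorProd Q l = algebraMap ℝ _ c ∧
      vectorProd Q l * star (vectorProd Q l) = algebraMap ℝ _ c := by
  induction l with
  | nil => exact ⟨1, by simp [vectorProd]⟩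
  | cons v l ih =>
    obtain ⟨c, hc, h1, h2⟩ := ih fun w hw => h w (List.mem_cons_of_mem v hw)
    have hv := h v List.mem_cons_self
    refine ⟨-Q v * c, ?_, ?_, ?_⟩
    · rcases hv with hv | hv <;> rw [hv] <;> linarith
    · rw [vectorProd, List.map_cons, List.prod_cons, star_mul, star_ι]
      calc star (vectorProd Q l) * -ι Q v * (ι Q v * vectorProd Q l)
          = -(star (vectorProd Q l) * (ι Q v * ι Q v) * vectorProd Q l) := by noncomm_ring
        _ = _ := by
          rw [ι_sq_scalar, ← Algebra.commutes, mul_assoc, h1, ← map_mul, ← map_neg, neg_mul]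
    · rw [vectorProd, List.map_cons, List.prod_cons, star_mul, star_ι]
      calc ι Q v * vectorProd Q l * (star (vectorProd Q l) * -ι Q v)
          = -(ι Q v * (vectorProd Q l * star (vectorProd Q l)) * ι Q v) := by noncomm_ring
        _ = _ := by
          rw [h2, ← Algebra.commutes, mul_assoc, ι_sq_scalar, ← map_mul, ← map_neg]
          congr 1; ring

theorem vectorProd_mem_evenOdd (l : List V) : vectorProd Q l ∈ evenOdd Q (l.length : ZMod 2) := by
  induction l with
  | nil => simpa [vectorProd] using SetLike.GradedOne.one_mem (A := evenOdd Q)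
  | cons v l ih =>
    rw [List.length_cons, Nat.cast_succ, add_comm]
    exact SetLike.mul_mem_graded (ι_mem_evenOdd_one Q v) ih

/-- Squaring removes both obstructions at once: the norm `c = ±1` becomes `1` and the degree becomes
even. -/
theorem vectorProd_sq_mem_spinGroup {l : List V} (h : ∀ v ∈ l, IsUnitVector Q v) :
    vectorProd Q l * vectorProd Q l ∈ spinGroup Q := by
  obtain ⟨c, hc, h1, h2⟩ := star_vectorProd_mul h
  set u := vectorProd Q l with hu
  refine ⟨⟨mul_mem (vectorProd_mem_lipschitzGroup h) (vectorProd_mem_lipschitzGroup h), ?_, ?_⟩,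
    ?_⟩
  · rw [star_mul]
    calc star u * star u * (u * u) = star u * (star u * u) * u := by noncomm_ring
      _ = 1 := by rw [h1, ← Algebra.commutes, mul_assoc, h1, ← map_mul, hc, map_one]
  · rw [star_mul]
    calc u * u * (star u * star u) = u * (u * star u) * star u := by noncomm_ring
      _ = 1 := by rw [h2, ← Algebra.commutes, mul_assoc, h2, ← map_mul, hc, map_one]
  · change u * u ∈ evenOdd Q 0
    have := SetLike.mul_mem_graded (vectorProd_mem_evenOdd (Q := Q) l)
      (vectorProd_mem_evenOdd (Q := Q) l)
    rwa [CharTwo.add_self_eq_zero] at this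

theorem Intertwines.sq_mul {l : List V} {S : V →ₗ[ℝ] V} (h : Intertwines Q l S LinearMap.id)
    (w : V) : vectorProd Q l * vectorProd Q l * ι Q (S (S w))
      = ι Q w * (vectorProd Q l * vectorProd Q l) := by
  rw [mul_assoc, h.2, mul_smul_comm, ← mul_assoc, LinearMap.id_apply, h.2, smul_mul_assoc,
    smul_smul, ← mul_pow, LinearMap.id_apply, mul_assoc]
  norm_num

end CliffordAlgebra

/-! ### The standard form of signature `(p, q)` -/

theorem polar_signatureForm {p q : ℕ} (v w : Fin p ⊕ Fin q → ℝ) :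
    QuadraticMap.polar (signatureForm p q) v w
      = ∑ i, 2 * Sum.elim (fun _ => (1 : ℝ)) (fun _ => (-1 : ℝ)) i * v i * w i := by
  simp only [QuadraticMap.polar, signatureForm, QuadraticMap.weightedSumSquares_apply,
    ← Finset.sum_sub_distrib, smul_eq_mul, Pi.add_apply]
  exact Finset.sum_congr rfl fun i _ => by ring

theorem polarBilin_signatureForm_surjective (p q : ℕ) :
    Function.Surjective (QuadraticMap.polarBilin (signatureForm p q)) := by
  intro d
  -- The polar form is twice the diagonal form with entries `±1`, hence the sign and the division by
  -- `2`.
  refine ⟨fun i => Sum.elim (fun _ => (1 : ℝ)) (fun _ => (-1 : ℝ)) i * d (Pi.single i 1) / 2, ?_⟩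
  refine LinearMap.pi_ext' fun i => LinearMap.ext_ring ?_
  simp only [LinearMap.comp_apply, QuadraticMap.polarBilin_apply_apply, polar_signatureForm]
  rw [Finset.sum_eq_single i]
  · rcases i with i | i <;> simp <;> ring
  · intro j _ hj
    simp [Pi.single_eq_of_ne hj]
  · simp

theorem polar_signatureForm_single {p q : ℕ} {i j : Fin p ⊕ Fin q} (h : i ≠ j) :
    QuadraticMap.polar (signatureForm p q) (Pi.single i 1) (Pi.single j 1) = 0 := by
  rw [polar_signatureForm]
  refine Finset.sum_eq_zero fun k _ => ?_
  by_cases hk : k = i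
  · subst hk; simp [Pi.single_eq_of_ne h]
  · simp [Pi.single_eq_of_ne hk]

theorem signatureForm_single {p q : ℕ} (i : Fin p ⊕ Fin q) :
    signatureForm p q (Pi.single i 1) = Sum.elim (fun _ => (1 : ℝ)) (fun _ => (-1 : ℝ)) i := by
  rw [signatureForm, QuadraticMap.weightedSumSquares_apply, Finset.sum_eq_single i]
  · simp
  · intro j _ hj
    simp [Pi.single_eq_of_ne hj]
  · simp

theorem signatureForm_single_ne_zero {p q : ℕ} (i : Fin p ⊕ Fin q) :
    signatureForm p q (Pi.single i 1) ≠ 0 := by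
  rw [signatureForm_single]; rcases i with i | i <;> simp

/-! ### Signature `(9,1)` as Hermitian octonionic matrices -/

/-- The underlying vector space of `signatureForm 9 1`. -/
abbrev Vec91 : Type := Fin 9 ⊕ Fin 1 → ℝ

/-- The quaternion with the given coordinates. -/
def quat (a b c d : ℝ) : ℍ[ℝ] := ⟨a, b, c, d⟩

@[simp] theorem re_quat (a b c d : ℝ) : (quat a b c d).re = a := rfl
@[simp] theorem imI_quat (a b c d : ℝ) : (quat a b c d).imI = b := rfl
@[simp] theorem imJ_quat (a b c d : ℝ) : (quat a b c d).imJ = c := rfl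
@[simp] theorem imK_quat (a b c d : ℝ) : (quat a b c d).imK = d := rfl

/-- The identification of `ℝ^(9,1)` with the Hermitian octonionic matrices. -/
def hermEquiv : Vec91 ≃ₗ[ℝ] Herm2 where
  toFun v := (v (.inr 0) + v (.inl 8), v (.inr 0) - v (.inl 8),
    mk (quat (v (.inl 0)) (v (.inl 1)) (v (.inl 2)) (v (.inl 3)))
      (quat (v (.inl 4)) (v (.inl 5)) (v (.inl 6)) (v (.inl 7))))
  map_add' v w := by
    refine Prod.ext ?_ (Prod.ext ?_ (ext_components ?_ ?_))
    · simp; ring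
    · simp; ring
    · ext <;> rfl
    · ext <;> rfl
  map_smul' r v := by
    refine Prod.ext ?_ (Prod.ext ?_ (ext_components ?_ ?_))
    · simp; ring
    · simp; ring
    · ext <;> rfl
    · ext <;> rfl
  invFun w := Sum.elim ![w.2.2.fst.re, w.2.2.fst.imI, w.2.2.fst.imJ, w.2.2.fst.imK,
    w.2.2.snd.re, w.2.2.snd.imI, w.2.2.snd.imJ, w.2.2.snd.imK, (w.1 - w.2.1) / 2]
    ![(w.1 + w.2.1) / 2]
  left_inv v := by
    ext i
    rcases i with i | i
    · fin_cases i <;> simp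
    · fin_cases i; simp
  right_inv w := by
    refine Prod.ext ?_ (Prod.ext ?_ (ext_components ?_ ?_))
    · simp; ring
    · simp; ring
    · ext <;> rfl
    · ext <;> rfl

/-- With `α = t + s` and `β = t - s` one has `-αβ = s² - t²`; the factor `2` appears because
`hermPolar` is a polar form. -/
theorem hermPolar_hermEquiv_self (v : Vec91) :
    hermPolar (hermEquiv v) (hermEquiv v) = 2 * signatureForm 9 1 v := by
  have e : signatureForm 9 1 v = v (.inl 0) * v (.inl 0) + v (.inl 1) * v (.inl 1)
      + v (.inl 2) * v (.inl 2) + v (.inl 3) * v (.inl 3) + v (.inl 4) * v (.inl 4)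
      + v (.inl 5) * v (.inl 5) + v (.inl 6) * v (.inl 6) + v (.inl 7) * v (.inl 7)
      + v (.inl 8) * v (.inl 8) - v (.inr 0) * v (.inr 0) := by
    rw [signatureForm, QuadraticMap.weightedSumSquares_apply, Fintype.sum_sum_type]
    simp only [Sum.elim_inl, Sum.elim_inr, Fin.sum_univ_succ, Finset.univ_eq_empty,
      Finset.sum_empty, smul_eq_mul]
    change 1 * (v (.inl 0) * v (.inl 0)) +
      (1 * (v (.inl 1) * v (.inl 1)) +
      (1 * (v (.inl 2) * v (.inl 2)) +
      (1 * (v (.inl 3) * v (.inl 3)) +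
      (1 * (v (.inl 4) * v (.inl 4)) +
      (1 * (v (.inl 5) * v (.inl 5)) +
      (1 * (v (.inl 6) * v (.inl 6)) +
      (1 * (v (.inl 7) * v (.inl 7)) +
      (1 * (v (.inl 8) * v (.inl 8)) +
      (0))))))))) +
      (-1 * (v (.inr 0) * v (.inr 0)) + 0) = _
    ring
  rw [e, hermPolar, inner_eq, Quaternion.inner_def, Quaternion.inner_def]
  simp [hermEquiv]
  ring

/-! ### The spinor representation of the Clifford algebra -/

/-- The Hermitian matrix `(-β, -α, z)` dual to `(α, β, z)`. -/
def hermDual : Herm2 →ₗ[ℝ] Herm2 where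
  toFun w := (-w.2.1, -w.1, w.2.2)
  map_add' v w := by ext <;> simp <;> ring
  map_smul' r v := by ext <;> simp

theorem C_R_mul_C_L_self (z : Octonion) :
    C.comp (R z) * C.comp (L z) = (inner ℝ z z : ℝ) • 1 := by
  ext x : 1
  change C (C (z * x) * z) = (inner ℝ z z : ℝ) • x
  rw [C_mul, C_C, C_mul_mul_self]

theorem C_L_mul_C_R_self (z : Octonion) :
    C.comp (L z) * C.comp (R z) = (inner ℝ z z : ℝ) • 1 := by
  ext x : 1
  change C (z * C (x * z)) = (inner ℝ z z : ℝ) • x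
  rw [C_mul, C_C, mul_mul_C_self]

/-- The dual is minus the adjugate: off-diagonal terms cancel, and the diagonal ones give `|z|² -
αβ` since `C x (x y) = |x|² y`. -/
theorem hermOp_mul_hermOp_dual (w : Herm2) :
    hermOp w * hermOp (hermDual w) = (hermPolar w w / 2) • 1 := by
  rw [← blockEnd_one, blockEnd_smul, hermOp_apply, hermOp_apply, blockEnd_mul]
  simp only [hermDual, LinearMap.coe_mk, AddHom.coe_mk, C_R_mul_C_L_self, C_L_mul_C_R_self,
    hermPolar]
  congr 1
  · ext x : 1
    simp [smul_smul]
    module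
  · ext x : 1; simp
  · ext x : 1; simp
  · ext x : 1
    simp [smul_smul]
    module

theorem hermDual_dual (w : Herm2) : hermDual (hermDual w) = w := by
  simp [hermDual]

theorem hermOp_dual_mul_hermOp (w : Herm2) :
    hermOp (hermDual w) * hermOp w = (hermPolar w w / 2) • 1 := by
  have h := hermOp_mul_hermOp_dual (hermDual w)
  rw [hermDual_dual] at h
  rw [h]
  congr 2
  simp [hermPolar, hermDual]; ring

/-- The gamma matrices. -/
def gamma : Vec91 →ₗ[ℝ] Matrix (Fin 2) (Fin 2) End2 where
  toFun v := !![0, hermOp (hermEquiv v); hermOp (hermDual (hermEquiv v)), 0]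
  map_add' v w := by
    ext1 i j; fin_cases i <;> fin_cases j <;> simp
  map_smul' r v := by
    ext1 i j; fin_cases i <;> fin_cases j <;> simp

theorem gamma_apply (v : Vec91) :
    gamma v = !![0, hermOp (hermEquiv v); hermOp (hermDual (hermEquiv v)), 0] := rfl

theorem gamma_mul_self (v : Vec91) :
    gamma v * gamma v = algebraMap ℝ _ (signatureForm 9 1 v) := by
  have h : hermPolar (hermEquiv v) (hermEquiv v) / 2 = signatureForm 9 1 v := by
    rw [hermPolar_hermEquiv_self]; ring
  rw [gamma_apply, Matrix.mul_fin_two, hermOp_mul_hermOp_dual, hermOp_dual_mul_hermOp, h]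
  ext1 i j
  fin_cases i <;> fin_cases j <;>
    simp [Matrix.algebraMap_matrix_apply, Algebra.algebraMap_eq_smul_one]

/-- The action of the Clifford algebra on spinors. -/
def spinorRep : CliffordAlgebra (signatureForm 9 1) →ₐ[ℝ] Matrix (Fin 2) (Fin 2) End2 :=
  CliffordAlgebra.lift _ ⟨gamma, gamma_mul_self⟩

theorem spinorRep_ι (v : Vec91) :
    spinorRep (CliffordAlgebra.ι _ v) = gamma v := CliffordAlgebra.lift_ι_apply _ _ _

theorem End2.neg_mul (M N : End2) : -M * N = -(M * N) := _root_.neg_mul M N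

theorem End2.mul_neg (M N : End2) : M * -N = -(M * N) := _root_.mul_neg M N

theorem spinorRep_involute (x : CliffordAlgebra (signatureForm 9 1)) :
    spinorRep (CliffordAlgebra.involute x)
      = !![spinorRep x 0 0, -spinorRep x 0 1; -spinorRep x 1 0, spinorRep x 1 1] := by
  induction x using CliffordAlgebra.induction with
  | algebraMap r =>
    rw [AlgHom.commutes, AlgHom.commutes]
    ext1 i j
    fin_cases i <;> fin_cases j <;> simp [Matrix.algebraMap_matrix_apply]
  | ι v =>
    rw [CliffordAlgebra.involute_ι, map_neg, spinorRep_ι, gamma_apply]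
    ext1 i j
    fin_cases i <;> fin_cases j <;> simp
  | mul x y hx hy =>
    rw [map_mul, map_mul, hx, hy, map_mul, Matrix.mul_fin_two]
    ext1 i j
    fin_cases i <;> fin_cases j <;>
      simp [Matrix.mul_apply, Fin.sum_univ_two, End2.neg_mul, End2.mul_neg] <;> abel
  | add x y hx hy =>
    rw [map_add, map_add, hx, hy, map_add]
    ext1 i j
    fin_cases i <;> fin_cases j <;> simp <;> abel

/-- Block transposition followed by exchange of the two half-spin spaces is an antiautomorphism. It
fixes every gamma matrix, because Hermitian operators are symmetric. -/
theorem spinorRep_reverse (x : CliffordAlgebra (signatureForm 9 1)) :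
    spinorRep (CliffordAlgebra.reverse x)
      = !![transposeEnd (spinorRep x 1 1), transposeEnd (spinorRep x 0 1);
          transposeEnd (spinorRep x 1 0), transposeEnd (spinorRep x 0 0)] := by
  induction x using CliffordAlgebra.induction with
  | algebraMap r =>
    rw [CliffordAlgebra.reverse.commutes, AlgHom.commutes]
    ext1 i j
    fin_cases i <;> fin_cases j <;>
      simp [Matrix.algebraMap_matrix_apply, Algebra.algebraMap_eq_smul_one, transposeEnd_one]
  | ι v =>
    rw [CliffordAlgebra.reverse_ι, spinorRep_ι, gamma_apply]
    ext1 i j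
    fin_cases i <;> fin_cases j <;> simp [transposeEnd_hermOp]
  | mul x y hx hy =>
    rw [CliffordAlgebra.reverse.map_mul, map_mul, hx, hy, map_mul, Matrix.mul_fin_two]
    ext1 i j
    fin_cases i <;> fin_cases j <;>
      simp [Matrix.mul_apply, Fin.sum_univ_two, transposeEnd_mul] <;> abel
  | add x y hx hy =>
    rw [map_add, map_add, hx, hy, map_add]
    ext1 i j
    fin_cases i <;> fin_cases j <;> simp

/-! ### The half-spin representation of `Spin(9,1)` -/

theorem isTopologicalRing_of_normedRing (𝔸 : Type*) [NormedRing 𝔸] : IsTopologicalRing 𝔸 :=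
  inferInstance

instance : IsTopologicalRing End2 := isTopologicalRing_of_normedRing End2

instance : IsTopologicalRing (Herm2 →L[ℝ] Herm2) :=
  isTopologicalRing_of_normedRing (Herm2 →L[ℝ] Herm2)

theorem eq_zero_of_eq_neg {M : Type*} [AddCommGroup M] [Module ℝ M] {x : M} (h : x = -x) :
    x = 0 := by
  have : (2 : ℝ) • x = 0 := by rw [two_smul]; nth_rewrite 2 [h]; exact add_neg_cancel x
  exact (smul_eq_zero.1 this).resolve_left two_ne_zero

theorem End2.smul_one_injective : Function.Injective fun r : ℝ => r • (1 : End2) := fun r s h => by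
  have hv := congrArg Prod.fst (DFunLike.congr_fun h ((1, 0) : Octonion2))
  have hv' : r • (1 : Octonion) = s • 1 := hv
  have := congrArg (inner ℝ (1 : Octonion)) hv'
  rwa [inner_smul_right, inner_smul_right, inner_one_one, mul_one, mul_one] at this

theorem spinorRep_offDiag {x : CliffordAlgebra (signatureForm 9 1)}
    (hx : CliffordAlgebra.involute x = x) : spinorRep x 0 1 = 0 ∧ spinorRep x 1 0 = 0 := by
  have h := spinorRep_involute x
  rw [hx] at h
  have h1 : spinorRep x 0 1 = -spinorRep x 0 1 := congrFun (congrFun h 0) 1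
  have h2 : spinorRep x 1 0 = -spinorRep x 1 0 := congrFun (congrFun h 1) 0
  exact ⟨eq_zero_of_eq_neg (M := End2) h1, eq_zero_of_eq_neg (M := End2) h2⟩

theorem spinorRep_mul_zero_zero {x : CliffordAlgebra (signatureForm 9 1)}
    (hx : CliffordAlgebra.involute x = x) (y : CliffordAlgebra (signatureForm 9 1)) :
    spinorRep (x * y) 0 0 = spinorRep x 0 0 * spinorRep y 0 0 := by
  rw [map_mul, Matrix.mul_apply, Fin.sum_univ_two, (spinorRep_offDiag hx).1]
  exact (congrArg _ (zero_mul _)).trans (add_zero _)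

/-- The half-spin representation, with values in `End(𝕆²)`. -/
def halfSpinEnd : Spin 9 1 →* End2 where
  toFun g := spinorRep (g : CliffordAlgebra (signatureForm 9 1)) 0 0
  map_one' := by
    change spinorRep 1 0 0 = 1
    rw [map_one]; rfl
  map_mul' g h := spinorRep_mul_zero_zero (spinGroup.involute_eq g.2) _

/-- The half-spin representation. -/
def halfSpin : Spin 9 1 →* GLOctonion2 := halfSpinEnd.toHomUnits

theorem halfSpin_apply (g : Spin 9 1) :
    (halfSpin g : End2) = spinorRep (g : CliffordAlgebra (signatureForm 9 1)) 0 0 := rfl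

theorem continuous_halfSpinEnd : Continuous halfSpinEnd := by
  let f : CliffordAlgebra (signatureForm 9 1) →ₗ[ℝ] End2 :=
    { toFun := fun x => spinorRep x 0 0
      map_add' := fun x y => by rw [map_add]; rfl
      map_smul' := fun r x => by rw [map_smul]; rfl }
  -- For the module topology, every linear map into a topological module is continuous.
  have : IsModuleTopology ℝ (CliffordAlgebra (signatureForm 9 1)) := ⟨rfl⟩
  have hf : Continuous f := IsModuleTopology.continuous_of_linearMap f
  exact hf.comp continuous_subtype_val

theorem continuous_halfSpin : Continuous halfSpin := by
  rw [Units.continuous_iff]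
  refine ⟨continuous_halfSpinEnd, ?_⟩
  have h : Continuous fun g : Spin 9 1 => g⁻¹ := by
    have : IsModuleTopology ℝ (CliffordAlgebra (signatureForm 9 1)) := ⟨rfl⟩
    refine Continuous.subtype_mk ?_ _
    have hs : Continuous fun x : CliffordAlgebra (signatureForm 9 1) => star x := by
      have hf : Continuous ((CliffordAlgebra.reverse (Q := signatureForm 9 1)) ∘ₗ
        (CliffordAlgebra.involute (Q := signatureForm 9 1)).toLinearMap) :=
        have := IsModuleTopology.toContinuousAdd ℝ (CliffordAlgebra (signatureForm 9 1))
        IsModuleTopology.continuous_of_linearMap _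
      exact hf
    exact hs.comp continuous_subtype_val
  refine (continuous_halfSpinEnd.comp h).congr fun g => ?_
  change (halfSpin g⁻¹ : End2) = _
  rw [map_inv]

/-- The lower right corner of `g (star g) = 1`: the other half-spin representation is the inverse
transpose of this one. -/
theorem halfSpin_mul_transposeEnd (g : Spin 9 1) :
    spinorRep (g : CliffordAlgebra (signatureForm 9 1)) 1 1 * transposeEnd (halfSpin g) = 1 := by
  have hg := spinGroup.involute_eq g.2
  have h := congrArg spinorRep (spinGroup.mul_star_self_of_mem g.2)
  rw [CliffordAlgebra.star_def, hg, map_mul, spinorRep_reverse, map_one] at h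
  have h0 := congrFun (congrFun h 1) 1
  rw [Matrix.mul_apply, Fin.sum_univ_two, (spinorRep_offDiag hg).2] at h0
  exact ((zero_add _).symm.trans (congrArg (· + _) (zero_mul _).symm)).trans h0

/-- The action of the spin group on vectors, in the half-spin representation. -/
theorem halfSpin_action {g : Spin 9 1} {v w : Vec91}
    (h : (g : CliffordAlgebra (signatureForm 9 1)) * CliffordAlgebra.ι (signatureForm 9 1) v
      = CliffordAlgebra.ι (signatureForm 9 1) w * (g : CliffordAlgebra (signatureForm 9 1))) :
    halfSpin g * hermOp (hermEquiv v) * transposeEnd (halfSpin g) = hermOp (hermEquiv w) := by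
  have h' := congrArg spinorRep h
  rw [map_mul, map_mul, spinorRep_ι, spinorRep_ι, gamma_apply, gamma_apply] at h'
  have h0 : (halfSpin g : End2) * hermOp (hermEquiv v)
      = hermOp (hermEquiv w) * spinorRep (g : CliffordAlgebra (signatureForm 9 1)) 1 1 := by
    have := congrFun (congrFun h' 0) 1
    simp only [Matrix.mul_apply, Fin.sum_univ_two] at this
    simp at this
    exact this
  rw [h0, mul_assoc, halfSpin_mul_transposeEnd, mul_one]

theorem exists_conj_eq (g : Spin 9 1) (v : Vec91) :
    ∃ w, (g : CliffordAlgebra (signatureForm 9 1)) * CliffordAlgebra.ι (signatureForm 9 1) v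
      = CliffordAlgebra.ι (signatureForm 9 1) w * (g : CliffordAlgebra (signatureForm 9 1)) ∧
      signatureForm 9 1 w = signatureForm 9 1 v := by
  have : Invertible (2 : ℝ) := invertibleOfNonzero two_ne_zero
  obtain ⟨w, hw⟩ := spinGroup.conjAct_smul_ι_mem_range_ι (x := spinGroup.toUnits g) g.2 v
  rw [ConjAct.units_smul_def] at hw
  obtain ⟨u, hu⟩ : ∃ u : (CliffordAlgebra (signatureForm 9 1))ˣ, u = spinGroup.toUnits g :=
    ⟨_, rfl⟩
  have hug : (g : CliffordAlgebra (signatureForm 9 1)) = u := by rw [hu]; rfl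
  change CliffordAlgebra.ι (signatureForm 9 1) w = ((spinGroup.toUnits g :
    (CliffordAlgebra (signatureForm 9 1))ˣ) : CliffordAlgebra (signatureForm 9 1))
    * CliffordAlgebra.ι (signatureForm 9 1) v
    * ((spinGroup.toUnits g : (CliffordAlgebra (signatureForm 9 1))ˣ)⁻¹ :
      (CliffordAlgebra (signatureForm 9 1))ˣ) at hw
  rw [← hu] at hw
  have hgv : (g : CliffordAlgebra (signatureForm 9 1)) * CliffordAlgebra.ι (signatureForm 9 1) v
      = CliffordAlgebra.ι (signatureForm 9 1) w * (g : CliffordAlgebra (signatureForm 9 1)) := by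
    rw [hw, hug, Units.inv_mul_cancel_right]
  refine ⟨w, hgv, ?_⟩
  -- Applying `g v = w g` twice gives `w² g = g v²`, so the squares of `v` and `w` agree.
  have h : algebraMap ℝ (CliffordAlgebra (signatureForm 9 1)) (signatureForm 9 1 w) * u
      = algebraMap ℝ (CliffordAlgebra (signatureForm 9 1)) (signatureForm 9 1 v) * u := by
    rw [hug] at hgv
    rw [← CliffordAlgebra.ι_sq_scalar, mul_assoc, ← hgv, ← mul_assoc, ← hgv, mul_assoc,
      CliffordAlgebra.ι_sq_scalar, Algebra.commutes]
  exact (algebraMap ℝ (CliffordAlgebra (signatureForm 9 1))).injective (u.mul_left_inj.1 h)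

/-- A kernel element acts trivially on Hermitian matrices, so it commutes with all vectors. Being
even, it is a scalar, and its half-spin image identifies that scalar as `1`. -/
theorem halfSpin_injective : Function.Injective halfSpin := by
  rw [injective_iff_map_eq_one]
  intro g hg
  have hinv := spinGroup.involute_eq g.2
  have h00 : (halfSpin g : End2) = 1 := by rw [hg]; rfl
  have hcomm : ∀ v, CliffordAlgebra.ι (signatureForm 9 1) v
      * (g : CliffordAlgebra (signatureForm 9 1))
      = (g : CliffordAlgebra (signatureForm 9 1)) * CliffordAlgebra.ι (signatureForm 9 1) v := fun v => by
    obtain ⟨w, hw, -⟩ := exists_conj_eq g v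
    have h := halfSpin_action hw
    rw [h00, transposeEnd_one, one_mul, mul_one] at h
    rw [hw, hermEquiv.injective (hermOp_injective h)]
  obtain ⟨r, hr⟩ := CliffordAlgebra.exists_eq_algebraMap_of_commute (Pi.basisFun ℝ _)
    (polarBilin_signatureForm_surjective 9 1) hinv hcomm
  rw [halfSpin_apply, hr, AlgHom.commutes, Matrix.algebraMap_matrix_apply, if_pos rfl,
    Algebra.algebraMap_eq_smul_one] at h00
  have := End2.smul_one_injective (h00.trans (one_smul ℝ _).symm)
  exact Subtype.ext (by rw [hr, this, map_one]; rfl)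

/-! ### The Lie algebra of the image -/

/-- The transpose as a continuous linear map. -/
def transposeL : End2 →L[ℝ] End2 := LinearMap.toContinuousLinearMap transposeEnd

@[simp] theorem transposeL_apply (M : End2) : transposeL M = transposeEnd M := rfl

/-- The continuous bilinear form `hermPolar`. -/
def hermPolarL : Herm2 →L[ℝ] Herm2 →L[ℝ] ℝ :=
  LinearMap.toContinuousBilinearMap
    (LinearMap.mk₂ ℝ hermPolar hermPolar_add_left hermPolar_smul_left
      (fun u v w => hermPolar_add_right v w u) fun r v w => hermPolar_smul_right r w v)

@[simp] theorem hermPolarL_apply (v w : Herm2) : hermPolarL v w = hermPolar v w := rfl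

/-! ### One-parameter groups acting by `X ↦ g X τ(g)` -/

section ExpAction

variable {𝔸 E : Type*} [NormedRing 𝔸] [NormedAlgebra ℝ 𝔸] [CompleteSpace 𝔸]
  [NormedAddCommGroup E] [NormedSpace ℝ E]

theorem hasDerivAt_exp_mul_mul_map_exp (τ : 𝔸 →L[ℝ] 𝔸) (hτ : ∀ x y, τ (x * y) = τ y * τ x)
    (A X : 𝔸) (t : ℝ) :
    HasDerivAt (fun s : ℝ => NormedSpace.exp (s • A) * X * τ (NormedSpace.exp (s • A)))
      (A * (NormedSpace.exp (t • A) * X * τ (NormedSpace.exp (t • A)))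
        + NormedSpace.exp (t • A) * X * τ (NormedSpace.exp (t • A)) * τ A) t := by
  have h := hasDerivAt_exp_smul_const' (𝕂 := ℝ) A t
  have hT := τ.hasFDerivAt.comp_hasDerivAt t h
  refine ((h.mul_const X).mul hT).congr_deriv ?_
  simp only [hτ, Function.comp_apply, mul_assoc]

/-- Both sides solve the linear equation with generator `X ↦ A X + X τ(A)` and initial value `H w`.
-/
theorem exp_mul_mul_map_exp [CompleteSpace E] {τ : 𝔸 →L[ℝ] 𝔸} (hτ : ∀ x y, τ (x * y) = τ y * τ x)
    (hτ1 : τ 1 = 1) {H : E →L[ℝ] 𝔸} {A : 𝔸} {D : E →L[ℝ] E}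
    (h : ∀ w, A * H w + H w * τ A = H (D w)) (w : E) (t : ℝ) :
    NormedSpace.exp (t • A) * H w * τ (NormedSpace.exp (t • A))
      = H (NormedSpace.exp (t • D) w) := by
  let 𝓛 : 𝔸 →L[ℝ] 𝔸 := ContinuousLinearMap.mul ℝ 𝔸 A + (ContinuousLinearMap.mul ℝ 𝔸).flip (τ A)
  have h1 := eq_exp_smul_apply_of_hasDerivAt (a := 𝓛)
    (fun s => hasDerivAt_exp_mul_mul_map_exp τ hτ A (H w) s) t
  have h2 := eq_exp_smul_apply_of_hasDerivAt (a := 𝓛) (f := fun s : ℝ =>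
    H (NormedSpace.exp (s • D) w)) (fun s => by
      change HasDerivAt _ (A * H _ + H _ * τ A) s
      rw [h]
      exact H.hasFDerivAt.comp_hasDerivAt s (hasDerivAt_exp_smul_apply D w s)) t
  have e : NormedSpace.exp ((0 : ℝ) • A) = 1 := by rw [zero_smul, NormedSpace.exp_zero]
  rw [h1, h2, e, hτ1, mul_one, one_mul, exp_zero_smul_apply]

theorem bilin_exp_of_skew [CompleteSpace E] {B : E →L[ℝ] E →L[ℝ] ℝ} {D : E →L[ℝ] E}
    (h : ∀ v w, B (D v) w + B v (D w) = 0) (v w : E) (t : ℝ) :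
    B (NormedSpace.exp (t • D) v) (NormedSpace.exp (t • D) w) = B v w := by
  have hd : ∀ s : ℝ, HasDerivAt (fun s : ℝ => B (NormedSpace.exp (s • D) v)
      (NormedSpace.exp (s • D) w)) 0 s := fun s => by
    have h1 := B.hasDerivAt_of_bilinear (fun _ => hasDerivAt_exp_smul_apply D v s)
      (fun _ => hasDerivAt_exp_smul_apply D w s)
    rwa [add_comm, h] at h1
  have hc := is_const_of_deriv_eq_zero (fun s => (hd s).differentiableAt)
    (fun s => (hd s).deriv) t 0
  simpa only [exp_zero_smul_apply] using hc

/-- A one-parameter group that acts on a subspace by isometries of a symmetric bilinear form acts,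
infinitesimally, by a skew-symmetric operator. -/
theorem exists_skew_of_exp_action {τ : 𝔸 →L[ℝ] 𝔸} (hτ : ∀ x y, τ (x * y) = τ y * τ x)
    (hτ1 : τ 1 = 1) {H : E →L[ℝ] 𝔸} {K : 𝔸 →L[ℝ] E} (hK : ∀ w, K (H w) = w)
    {B : E →L[ℝ] E →L[ℝ] ℝ} (hB : ∀ v w, B v w = B w v) {A : 𝔸}
    (h : ∀ (t : ℝ) w, ∃ u, NormedSpace.exp (t • A) * H w * τ (NormedSpace.exp (t • A)) = H u ∧
      B u u = B w w) :
    ∃ D : E →L[ℝ] E, (∀ v w, B (D v) w + B v (D w) = 0) ∧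
      ∀ w, A * H w + H w * τ A = H (D w) := by
  -- The orbit of `H w` stays in the range of `H`, so the retraction `K` turns it into a curve `T t
  -- w` in `E`, and `D` is the derivative of `T` at `0`.
  let D : E →L[ℝ] E := K.comp ((ContinuousLinearMap.mul ℝ 𝔸 A
    + (ContinuousLinearMap.mul ℝ 𝔸).flip (τ A)).comp H)
  let T : ℝ → E →L[ℝ] E := fun t => K.comp ((ContinuousLinearMap.mul ℝ 𝔸 (NormedSpace.exp (t • A))
    ).comp (((ContinuousLinearMap.mul ℝ 𝔸).flip (τ (NormedSpace.exp (t • A)))).comp H))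
  have hT : ∀ t w, T t w = K (NormedSpace.exp (t • A) * H w * τ (NormedSpace.exp (t • A))) :=
    fun t w => congrArg K (mul_assoc _ _ _).symm
  have hHT : ∀ t w, H (T t w) = NormedSpace.exp (t • A) * H w * τ (NormedSpace.exp (t • A)) :=
    fun t w => by
      obtain ⟨u, hu, -⟩ := h t w
      rw [hT, hu, hK]
  have hBT : ∀ t w, B (T t w) (T t w) = B w w := fun t w => by
    obtain ⟨u, hu, hq⟩ := h t w
    rw [hT, hu, hK, hq]
  have hBT' : ∀ t v w, B (T t v) (T t w) = B v w := fun t v w => by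
    have h1 := hBT t (v + w)
    simp only [map_add, add_apply, hBT] at h1
    have h2 := hB (T t w) (T t v)
    have h3 := hB w v
    linarith
  have e : NormedSpace.exp ((0 : ℝ) • A) = 1 := by rw [zero_smul, NormedSpace.exp_zero]
  have hA : ∀ w, HasDerivAt
      (fun s : ℝ => NormedSpace.exp (s • A) * H w * τ (NormedSpace.exp (s • A)))
      (A * H w + H w * τ A) 0 := fun w => by
    have h1 := hasDerivAt_exp_mul_mul_map_exp τ hτ A (H w) 0
    rwa [e, hτ1, mul_one, one_mul] at h1
  have hd : ∀ w, HasDerivAt (fun t => T t w) (D w) 0 := fun w => by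
    simp only [hT]
    exact K.hasFDerivAt.comp_hasDerivAt (0 : ℝ) (hA w)
  have h0 : ∀ w, T 0 w = w := fun w => by
    rw [hT, e, hτ1, mul_one, one_mul, hK]
  refine ⟨D, fun v w => ?_, fun w => ?_⟩
  · have h1 := B.hasDerivAt_of_bilinear (fun _ => hd v) (fun _ => hd w)
    simp only [hBT', h0] at h1
    have := h1.unique (hasDerivAt_const (0 : ℝ) (B v w))
    rw [add_comm, this]
  · have h2 := H.hasFDerivAt.comp_hasDerivAt (0 : ℝ) (hd w)
    refine (hA w).unique (h2.congr_of_eventuallyEq (Filter.Eventually.of_forall fun t => ?_))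
    exact (hHT t w).symm

end ExpAction

/-- `hermOp` as a continuous linear map. -/
def hermOpL : Herm2 →L[ℝ] End2 := LinearMap.toContinuousLinearMap hermOp

/-- `hermCoord` as a continuous linear map. -/
def hermCoordL : End2 →L[ℝ] Herm2 := LinearMap.toContinuousLinearMap hermCoord

theorem mem_spin91_of_exp_mem {A : End2}
    (hA : A ∈ lieAlgebraOf halfSpin.range) : A ∈ spin91 := by
  rw [spin91_eq]
  obtain ⟨D, hD, hD'⟩ := exists_skew_of_exp_action (τ := transposeL) (H := hermOpL)
    (K := hermCoordL) (B := hermPolarL) (A := A) transposeEnd_mul transposeEnd_one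
    hermCoord_hermOp hermPolar_comm fun t w => by
      obtain ⟨_, ⟨g, rfl⟩, hg⟩ := hA t
      obtain ⟨v, rfl⟩ := hermEquiv.surjective w
      obtain ⟨u, hu, hq⟩ := exists_conj_eq g v
      have ha := halfSpin_action hu
      rw [hg] at ha
      refine ⟨hermEquiv u, ha, ?_⟩
      rw [hermPolarL_apply, hermPolarL_apply, hermPolar_hermEquiv_self, hermPolar_hermEquiv_self,
        hq]
  exact ⟨D, hD, hD'⟩

theorem ActsThrough.exp_action {A : End2} {D : Herm2 →L[ℝ] Herm2} (h : ActsThrough A D)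
    (w : Herm2) (t : ℝ) :
    NormedSpace.exp (t • A) * hermOp w * transposeEnd (NormedSpace.exp (t • A))
      = hermOp (NormedSpace.exp (t • D) w) :=
  exp_mul_mul_map_exp (τ := transposeL) (H := hermOpL) (A := A) (D := D) transposeEnd_mul
    transposeEnd_one h.action w t

theorem ActsThrough.hermPolar_exp {A : End2} {D : Herm2 →L[ℝ] Herm2} (h : ActsThrough A D)
    (v w : Herm2) (t : ℝ) :
    hermPolar (NormedSpace.exp (t • D) v) (NormedSpace.exp (t • D) w) = hermPolar v w :=
  bilin_exp_of_skew (B := hermPolarL) h.skew v w t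

/-- The operators that commute with all Hermitian matrices and are orthogonal are `±1`. -/
theorem eq_one_or_neg_one_of_commute {K : End2} (h : ∀ w, K * hermOp w = hermOp w * K)
    (hK : K * transposeEnd K = 1) : K = 1 ∨ K = -1 := by
  obtain ⟨a, b, c, d, rfl⟩ := exists_eq_blockEnd K
  have hR : C.comp (R 0) = 0 := by ext x : 1; simp
  have hL : C.comp (L 0) = 0 := by ext x : 1; simp
  -- Commuting with the diagonal idempotent removes the off-diagonal blocks.
  have k1 := h (1, 0, 0)
  simp only [hermOp_apply, blockEnd_mul, hR, hL, one_smul,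
      zero_smul, mul_zero, zero_mul, mul_one, one_mul, add_zero] at k1
  obtain ⟨-, rfl, rfl, -⟩ := blockEnd_injective k1
  have k2 : ∀ z, a * C.comp (R z) = C.comp (R z) * d ∧ d * C.comp (L z) = C.comp (L z) * a :=
    fun z => by
      have k := h (0, 0, z)
      simp only [hermOp_apply, blockEnd_mul,
        zero_smul, mul_zero, zero_mul, add_zero, zero_add] at k
      obtain ⟨-, h1, h2, -⟩ := blockEnd_injective k
      exact ⟨h1, h2⟩
  have hd : ∀ y, d y = C (a (C y)) := fun y => by
    have : a (C (y * 1)) = C (d y * 1) := DFunLike.congr_fun (k2 1).1 y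
    rw [mul_one', mul_one'] at this
    rw [this, C_C]
  have ha : ∀ z x, a (z * x) = z * a x := fun z x => by
    have : d (C (z * x)) = C (z * a x) := DFunLike.congr_fun (k2 z).2 x
    rw [hd, C_C] at this
    simpa using congrArg C this
  -- An operator commuting with all left multiplications is right multiplication by `a 1`, and this
  -- forces `a 1` into the nucleus.
  obtain ⟨r, hr⟩ := eq_smul_one_of_forall_mul_assoc (c := a 1) fun x y => by
    rw [← ha, ← ha, ← ha, mul_one', mul_one']
  have ea : a = r • 1 := by
    ext x : 1
    have := ha x 1
    rw [mul_one', hr, mul_smul', mul_one'] at this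
    exact this
  have ed : d = r • 1 := by
    ext x : 1
    rw [hd, ea]
    simp
  have eK : blockEnd a 0 0 d = r • 1 := by
    rw [ea, ed, ← blockEnd_one, blockEnd_smul, smul_zero]
  rw [eK] at hK ⊢
  rw [map_smul, transposeEnd_one, smul_mul_smul_comm, mul_one] at hK
  have hr2 : r * r = 1 := End2.smul_one_injective (hK.trans (one_smul ℝ (1 : End2)).symm)
  rcases mul_self_eq_one_iff.1 hr2 with rfl | rfl
  · left; exact one_smul _ _
  · right; exact (neg_smul (1 : ℝ) (1 : End2)).trans (congrArg _ (one_smul _ _))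

theorem neg_one_mem_spinGroup : (-1 : CliffordAlgebra (signatureForm 9 1)) ∈ spinGroup _ := by
  have hq := signatureForm_single (p := 9) (q := 1) (.inl 0)
  rw [Sum.elim_inl] at hq
  set e : Vec91 := Pi.single (.inl 0) 1
  -- Since `e² = 1`, the product of `e` and `-e` is `-1`.
  have hl := CliffordAlgebra.vectorProd_mem_lipschitzGroup (Q := signatureForm 9 1) (l := [e, -e])
    fun v hv => by
      simp only [List.mem_cons, List.not_mem_nil, or_false] at hv
      rcases hv with rfl | rfl
      · exact Or.inl hq
      · exact Or.inl ((QuadraticMap.map_neg _ _).trans hq)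
  have he : CliffordAlgebra.vectorProd (signatureForm 9 1) [e, -e] = -1 := by
    simp [CliffordAlgebra.vectorProd, CliffordAlgebra.ι_sq_scalar, hq]
  rw [he] at hl
  refine ⟨⟨hl, ?_, ?_⟩, (CliffordAlgebra.even _).neg_mem (one_mem _)⟩ <;> simp

theorem exp_mem_range_of_actsThrough {A : End2} {D : Herm2 →L[ℝ] Herm2} (h : ActsThrough A D) :
    ∃ g ∈ halfSpin.range, (g : End2) = NormedSpace.exp A := by
  -- Half of `D` is used so that the square of the product of vectors attached to `S₀` corresponds
  -- to `exp D`.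
  let S₀ : Herm2 →L[ℝ] Herm2 := NormedSpace.exp ((2⁻¹ : ℝ) • D)
  let S : Vec91 →ₗ[ℝ] Vec91 := hermEquiv.symm.toLinearMap ∘ₗ (S₀ : Herm2 →ₗ[ℝ] Herm2) ∘ₗ
    hermEquiv.toLinearMap
  have hS : ∀ v, hermEquiv (S v) = S₀ (hermEquiv v) := fun v => by simp [S]
  have hQ : ∀ v, signatureForm 9 1 (S v) = signatureForm 9 1 v := fun v => by
    have h1 := hermPolar_hermEquiv_self (S v)
    rw [hS, h.hermPolar_exp, hermPolar_hermEquiv_self] at h1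
    linarith
  obtain ⟨l, hl⟩ := CliffordAlgebra.exists_intertwines_id (Q := signatureForm 9 1)
    (e := fun i : Fin 9 ⊕ Fin 1 => (Pi.single i 1 : Vec91))
    ((congrArg (fun e : Fin 9 ⊕ Fin 1 → Vec91 => Submodule.span ℝ (Set.range e))
      (funext fun i => (Pi.basisFun_apply ℝ (Fin 9 ⊕ Fin 1) i).symm)).trans
        (Pi.basisFun ℝ (Fin 9 ⊕ Fin 1)).span_eq)
    signatureForm_single_ne_zero (fun _ _ h => polar_signatureForm_single h) hQ
  let g : Spin 9 1 := ⟨_, CliffordAlgebra.vectorProd_sq_mem_spinGroup hl.1⟩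
  obtain ⟨e, he⟩ := exists_unit_eq_exp A
  have hexp : ∀ w, (e : End2) * hermOp w * transposeEnd e = hermOp (S₀ (S₀ w)) := fun w => by
    have h1 := h.exp_action w 1
    rw [one_smul, one_smul, ← he, exp_eq_sq D] at h1
    exact h1
  -- The vectors carry `S` to the identity, so `g` undoes the action of `exp A` and `K` below fixes
  -- every Hermitian matrix.
  have hg : ∀ w, (halfSpin g : End2) * hermOp (S₀ (S₀ w)) * transposeEnd (halfSpin g)
      = hermOp w := fun w => by
    obtain ⟨v, rfl⟩ := hermEquiv.surjective w
    rw [← hS, ← hS]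
    exact halfSpin_action (hl.sq_mul v)
  set K : GLOctonion2 := halfSpin g * e with hK
  have hKact : ∀ w, (K : End2) * hermOp w * transposeEnd K = hermOp w := fun w => by
    rw [hK, Units.val_mul, transposeEnd_mul]
    calc _ = (halfSpin g : End2) * (e * hermOp w * transposeEnd e) * transposeEnd (halfSpin g) := by
          simp only [mul_assoc]
      _ = _ := by rw [hexp, hg]
  -- Fixing the identity matrix makes `K` orthogonal, so that `K X Kᵀ = X` becomes commutation with
  -- `X`.
  have h1 : hermOp (1, 1, 0) = 1 := by
    have hR : C.comp (R 0) = 0 := by ext x : 1; simp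
    have hL : C.comp (L 0) = 0 := by ext x : 1; simp
    rw [hermOp_apply, hR, hL, one_smul, blockEnd_one]
  have hKt : (K : End2) * transposeEnd K = 1 := by
    have := hKact (1, 1, 0)
    rwa [h1, mul_one] at this
  have hKt' : transposeEnd K * (K : End2) = 1 := by
    rw [← K.inv_mul, eq_comm]
    congr 1
    exact Units.inv_eq_of_mul_eq_one_right hKt
  have hcomm : ∀ w, (K : End2) * hermOp w = hermOp w * K := fun w => by
    conv_rhs => rw [← hKact w, mul_assoc, hKt', mul_one]
  have hgK : (e : End2) = (halfSpin g⁻¹ : GLOctonion2) * (K : End2) := by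
    rw [hK, ← Units.val_mul, map_inv, inv_mul_cancel_left]
  rcases eq_one_or_neg_one_of_commute hcomm hKt with hK1 | hK1
  · exact ⟨_, ⟨g⁻¹, rfl⟩, by rw [← he, hgK, hK1, mul_one]⟩
  · let m : Spin 9 1 := ⟨-1, neg_one_mem_spinGroup⟩
    have hm : (halfSpin m : End2) = -1 := by
      rw [halfSpin_apply]
      change spinorRep (-1) 0 0 = -1
      rw [map_neg, map_one]; rfl
    exact ⟨_, ⟨g⁻¹ * m, rfl⟩, by rw [← he, hgK, hK1, map_mul, Units.val_mul, hm]⟩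

theorem isFaithfulRep_halfSpin : IsFaithfulRepWithLieAlgebraSpin91 halfSpin where
  continuous := continuous_halfSpin
  faithful := halfSpin_injective
  lieAlgebra_eq := by
    refine Set.Subset.antisymm (fun A hA => mem_spin91_of_exp_mem hA) fun A hA t => ?_
    rw [spin91_eq] at hA
    obtain ⟨D, hD⟩ := hA
    exact exp_mem_range_of_actsThrough (hD.smul t)

/-! ### Transitivity on nonzero vectors -/

theorem exp_apply_of_apply_apply_eq_zero {F : Type*} [NormedAddCommGroup F] [NormedSpace ℝ F]
    [CompleteSpace F] {N : F →L[ℝ] F} (h : ∀ x, N (N x) = 0) (x : F) :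
    NormedSpace.exp N x = x + N x := by
  have h1 := eq_exp_smul_apply_of_hasDerivAt (a := N) (f := fun t : ℝ => x + t • N x) (fun s => by
    simpa [h] using ((hasDerivAt_id s).smul_const (N x)).const_add x) 1
  simpa using h1.symm

namespace Octonion

theorem inner_self_ne_zero' {v : Octonion} (hv : v ≠ 0) : (inner ℝ v v : ℝ) ≠ 0 :=
  fun h => hv (inner_self_eq_zero.1 h)

theorem exists_C_mul_eq_of_left_ne_zero {v : Octonion} (hv : v ≠ 0) (t : Octonion) :
    ∃ w, C (v * w) = t := by
  refine ⟨(inner ℝ v v : ℝ)⁻¹ • (C v * C t), ?_⟩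
  have h := C_mul_mul_self (C v) (C t)
  rw [C_C, inner_C_left, C_C] at h
  rw [mul_smul', h, inv_smul_smul₀ (inner_self_ne_zero' hv), C_C]

theorem exists_C_mul_eq_of_right_ne_zero {u : Octonion} (hu : u ≠ 0) (t : Octonion) :
    ∃ x, C (x * u) = t := by
  refine ⟨(inner ℝ u u : ℝ)⁻¹ • (C t * C u), ?_⟩
  have h := mul_mul_C_self (C u) (C t)
  rw [C_C, inner_C_left, C_C] at h
  rw [smul_mul', h, inv_smul_smul₀ (inner_self_ne_zero' hu), C_C]

end Octonion

section Transitivity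

variable {ρ : Spin 9 1 →* GLOctonion2}

/-- Square-zero elements exponentiate to `1 + N`. Only the Lie algebra of the image is used, so the
orbit count holds for every admissible `ρ`. -/
theorem exists_apply_eq_add (h : lieAlgebraOf ρ.range = spin91) {N : End2}
    (hN : ∃ D, ActsThrough N D)
    (hNN : ∀ x, N (N x) = 0) : ∃ g, ∀ x, (ρ g : End2) x = x + N x := by
  have hmem : N ∈ lieAlgebraOf ρ.range := by
    rw [h, spin91_eq]
    exact hN
  obtain ⟨_, ⟨g, rfl⟩, hg⟩ := hmem 1
  refine ⟨g, fun x => ?_⟩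
  rw [hg]
  exact (congrArg (fun M : End2 => NormedSpace.exp M x) (one_smul ℝ N)).trans
    (exp_apply_of_apply_apply_eq_zero hNN x)

/-- An upper shear adds `C (v w)` to the first coordinate, and this is an arbitrary octonion because
`v` is invertible. -/
theorem exists_apply_of_snd_ne_zero (h : lieAlgebraOf ρ.range = spin91) {v : Octonion} (hv : v ≠ 0)
    (u u' : Octonion) : ∃ g, (ρ g : End2) (u, v) = (u', v) := by
  obtain ⟨w, hw⟩ := exists_C_mul_eq_of_left_ne_zero hv (u' - u)
  obtain ⟨g, hg⟩ := exists_apply_eq_add h (actsThrough_upper w) fun x => by simp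
  exact ⟨g, by simp [hg, hw]⟩

theorem exists_apply_of_fst_ne_zero (h : lieAlgebraOf ρ.range = spin91) {u : Octonion} (hu : u ≠ 0)
    (v v' : Octonion) : ∃ g, (ρ g : End2) (u, v) = (u, v') := by
  obtain ⟨w, hw⟩ := exists_C_mul_eq_of_right_ne_zero hu (v' - v)
  obtain ⟨g, hg⟩ := exists_apply_eq_add h (actsThrough_lower w) fun x => by simp
  exact ⟨g, by simp [hg, hw]⟩

theorem exists_apply_trans {x y z : Octonion2} (h₁ : ∃ g, (ρ g : End2) x = y)
    (h₂ : ∃ g, (ρ g : End2) y = z) : ∃ g, (ρ g : End2) x = z := by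
  obtain ⟨g, rfl⟩ := h₁
  obtain ⟨k, rfl⟩ := h₂
  exact ⟨k * g, by rw [map_mul]; rfl⟩

theorem Octonion.one_ne_zero' : (1 : Octonion) ≠ 0 := fun h => by
  have := inner_one_one
  rw [h, inner_zero_left] at this
  exact zero_ne_one this

/-- The group is transitive on nonzero vectors. -/
theorem exists_apply_eq_of_ne_zero (h : lieAlgebraOf ρ.range = spin91) {x y : Octonion2}
    (hx : x ≠ 0) (hy : y ≠ 0) : ∃ g, (ρ g : End2) x = y := by
  obtain ⟨u, v⟩ := x
  obtain ⟨u', v'⟩ := y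
  have h1 := Octonion.one_ne_zero'
  -- Both coordinates of the intermediate point `(1, 1)` are nonzero, so two shears suffice on
  -- either side; the order depends on which coordinate is known to be nonzero.
  have hto : ∃ g, (ρ g : End2) (u, v) = (1, 1) := by
    by_cases hv : v = 0
    · have hu : u ≠ 0 := fun hu => hx (by rw [hu, hv]; rfl)
      exact exists_apply_trans (exists_apply_of_fst_ne_zero h hu v 1)
        (exists_apply_of_snd_ne_zero h h1 u 1)
    · exact exists_apply_trans (exists_apply_of_snd_ne_zero h hv u 1)
        (exists_apply_of_fst_ne_zero h h1 v 1)
  have hfrom : ∃ g, (ρ g : End2) (1, 1) = (u', v') := by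
    by_cases hv : v' = 0
    · have hu : u' ≠ 0 := fun hu => hy (by rw [hu, hv]; rfl)
      exact exists_apply_trans (exists_apply_of_snd_ne_zero h h1 1 u')
        (exists_apply_of_fst_ne_zero h hu 1 v')
    · exact exists_apply_trans (exists_apply_of_fst_ne_zero h h1 1 v')
        (exists_apply_of_snd_ne_zero h hv 1 u')
  exact exists_apply_trans hto hfrom

theorem orbit_eq_of_ne_zero (h : lieAlgebraOf ρ.range = spin91) {x : Octonion2} (hx : x ≠ 0) :
    Set.range (fun g : Spin 9 1 => (ρ g : End2) x) = {y | y ≠ 0} := by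
  ext y
  refine ⟨?_, fun hy => exists_apply_eq_of_ne_zero h hx hy⟩
  rintro ⟨g, rfl⟩ h0
  have e : ((ρ g)⁻¹ : GLOctonion2).val ((ρ g : End2) x) = x :=
    DFunLike.congr_fun (ρ g).inv_mul x
  change (ρ g : End2) x = 0 at h0
  rw [h0, map_zero] at e
  exact hx e.symm

theorem orbit_zero : Set.range (fun g : Spin 9 1 => (ρ g : End2) 0) = {0} := by
  simp only [map_zero, Set.range_const]

end Transitivity

end

theorem mainTheorem7 :
    (∃ S : Submodule ℝ (Octonion2 →L[ℝ] Octonion2),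
      (S : Set (Octonion2 →L[ℝ] Octonion2)) = spin91 ∧
      (∀ A ∈ S, ∀ B ∈ S, A * B - B * A ∈ S) ∧
      ∀ A ∈ S, LinearMap.trace ℝ Octonion2 (A : Octonion2 →ₗ[ℝ] Octonion2) = 0) ∧
    (∃ ρ : Spin 9 1 →* GLOctonion2, IsFaithfulRepWithLieAlgebraSpin91 ρ) ∧
    ∀ ρ : Spin 9 1 →* GLOctonion2, IsFaithfulRepWithLieAlgebraSpin91 ρ →
      Set.range (fun v : Octonion2 =>
          Set.range (fun g : Spin 9 1 => (ρ g : Octonion2 →L[ℝ] Octonion2) v)) =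
        {{0}, {v : Octonion2 | v ≠ 0}} := by
  refine ⟨⟨hermStabilizer, spin91_eq.symm, ?_, fun A hA => ?_⟩,
    ⟨halfSpin, isFaithfulRep_halfSpin⟩, fun ρ hρ => ?_⟩
  · rintro A ⟨D, hD⟩ B ⟨E, hE⟩
    exact ⟨_, hD.bracket hE⟩
  · refine trace_eq_zero_of_mem_spin91 ?_
    rw [spin91_eq]
    exact hA
  · have h := hρ.lieAlgebra_eq
    ext s
    simp only [Set.mem_range, Set.mem_insert_iff, Set.mem_singleton_iff]
    constructor
    · rintro ⟨x, rfl⟩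
      by_cases hx : x = 0
      · exact .inl (by rw [hx]; exact orbit_zero)
      · exact .inr (orbit_eq_of_ne_zero h hx)
    · rintro (rfl | rfl)
      · exact ⟨0, orbit_zero⟩
      · exact ⟨(1, 0), orbit_eq_of_ne_zero h fun e =>
          Octonion.one_ne_zero' (congrArg Prod.fst e)⟩
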